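/- Let $\Gamma$ be a finite undirected connected graph without loops or multiple edges, with vertex set $X$, path-length distance $\partial$ and diameter $D\ge 3$. For $x\in X$ and $i \geq 0$ write $\Gamma_i(x)=\{y\in X:\partial(x,y)=i\}$. Assume that $\Gamma$ is distance-regular: for $0\le h,i,j\le D$ and all $x,y\in X$ with $\partial(x,y)=h$, the number $p^h_{i,j}=|\Gamma_i(x)\cap\Gamma_j(y)|$ depends only on $h,i,j$. Assume that the valency $k=p^0_{1,1}$ is at least $3$, and write $a_i=p^i_{1,i}$ for $0\le i\le D$. Let $V=\mathbb R^X$, let $\hat x\in V$ be the standard basis vector at $x\in X$, and let $\circ$ denote the entrywise product of vectors or of matrices. Let $M$ be the span of the distance matrices $A_0,\dots,A_D$, where $(A_i)_{x,y}=1$ if $\partial(x,y)=i$ and $(A_i)_{x,y}=0$ otherwise. Let $E_0,\dots,E_D$ be an ordering of the primitive idempotents of $\Gamma$; that is, $E_0,\dots,E_D$ is a basis of $M$ with $E_0=|X|^{-1}J$ (where $J$ is the all-ones matrix), $\sum_{i=0}^D E_i=I$, $E_i^t=E_i$ and $E_iE_j=\delta_{i,j}E_i$ for $0\le i,j\le D$.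 The Krein parameters $q^h_{i,j}\in\mathbb R$ are defined by $E_i\circ E_j=|X|^{-1}\sum_{h=0}^D q^h_{i,j}E_h$ for $0\le i,j\le D$. Assume that the ordering is $Q$-polynomial: for $0\le h,i,j\le D$, $q^h_{i,j}=0$ if one of $h,i,j$ is greater than the sum of the other two, and $q^h_{i,j}\ne0$ if one of $h,i,j$ is equal to the sum of the other two. Write $a^*_i=q^i_{1,i}$ for $0\le i\le D$, and put $E=E_1$. For $u,v\in EV$ let $u\star v=E(u\circ v)$ (the Norton product). Assume that $\Gamma$ is tight: $\Gamma$ is not bipartite (that is, $a_i\neq 0$ for some $0\le i\le D$) and $a_D=a^*_D=0$. Then the set $\{E\hat x : x\in X\}$ is Norton-balanced: for all $x,y\in X$ and $0\le i,j\le D$, $$\sum_{z\in\Gamma_i(x)\cap\Gamma_j(y)}E\hat z\in\operatorname{Span}\{E\hat x,\;E\hat y,\;E\hat x\star E\hat y\}.$$ -/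

import Mathlib

open scoped Matrix

namespace DRG

/-- The sphere `Γ_i(x)`: the vertices at distance `i` from `x`. -/
noncomputable def sphere {X : Type*} [Fintype X] (Γ : SimpleGraph X) (i : ℕ) (x : X) : Finset X :=
  Finset.univ.filter (fun y => Γ.dist x y = i)

/-- A finite connected graph of diameter `D` is distance-regular if for all `0 ≤ h, i, j ≤ D` the
number `|Γ_i(x) ∩ Γ_j(y)|` is the same for all vertices `x, y` at distance `h`. -/
def IsDistanceRegular {X : Type*} [Fintype X] [DecidableEq X] (Γ : SimpleGraph X) : Prop :=
  Γ.Connected ∧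
    ∀ h i j : ℕ, h ≤ Γ.diam → i ≤ Γ.diam → j ≤ Γ.diam →
      ∀ x y x' y' : X, Γ.dist x y = h → Γ.dist x' y' = h →
        (sphere Γ i x ∩ sphere Γ j y).card = (sphere Γ i x' ∩ sphere Γ j y').card

open Classical in
/-- The intersection number `p^h_{i,j}`: the common value of `|Γ_i(x) ∩ Γ_j(y)|` over the vertices
`x, y` at distance `h` (and `0` if there are no such vertices). -/
noncomputable def intersectionNumber {X : Type*} [Fintype X] [DecidableEq X] (Γ : SimpleGraph X)
    (h i j : ℕ) : ℕ :=
  if hp : ∃ p : X × X, Γ.dist p.1 p.2 = h then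
    (sphere Γ i hp.choose.1 ∩ sphere Γ j hp.choose.2).card
  else 0

theorem card_inter_eq_intersectionNumber {X : Type*} [Fintype X] [DecidableEq X]
    {Γ : SimpleGraph X} (hΓ : IsDistanceRegular Γ) {h i j : ℕ} (hh : h ≤ Γ.diam)
    (hi : i ≤ Γ.diam) (hj : j ≤ Γ.diam) {x y : X} (hxy : Γ.dist x y = h) :
    (sphere Γ i x ∩ sphere Γ j y).card = intersectionNumber Γ h i j := by
  have hp : ∃ p : X × X, Γ.dist p.1 p.2 = h := ⟨(x, y), hxy⟩
  rw [intersectionNumber, dif_pos hp]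
  exact hΓ.2 h i j hh hi hj _ _ _ _ hxy hp.choose_spec

/-- The valency `k = p^0_{1,1}`. -/
noncomputable def valency {X : Type*} [Fintype X] [DecidableEq X] (Γ : SimpleGraph X) : ℕ :=
  intersectionNumber Γ 0 1 1

/-- The intersection number `a_i = p^i_{1,i}`. -/
noncomputable def a {X : Type*} [Fintype X] [DecidableEq X] (Γ : SimpleGraph X) (i : ℕ) : ℕ :=
  intersectionNumber Γ i 1 i

/-- Bipartite distance-regular graph: `a_i = 0` for `0 ≤ i ≤ D`. -/
def IsBipartite {X : Type*} [Fintype X] [DecidableEq X] (Γ : SimpleGraph X) : Prop :=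
  ∀ i : ℕ, i ≤ Γ.diam → a Γ i = 0

/-- The `i`th distance matrix `A_i`. -/
noncomputable def distanceMatrix {X : Type*} (Γ : SimpleGraph X) (i : ℕ) : Matrix X X ℝ :=
  Matrix.of fun x y => if Γ.dist x y = i then 1 else 0

/-- The Bose-Mesner algebra, as a subspace: the span of `A_0, …, A_D`. -/
def boseMesner {X : Type*} (Γ : SimpleGraph X) : Submodule ℝ (Matrix X X ℝ) :=
  Submodule.span ℝ {B | ∃ i : ℕ, i ≤ Γ.diam ∧ B = distanceMatrix Γ i}

/-- `E_0, …, E_D` is an ordering of the primitive idempotents of `Γ`, the trivial one first. -/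
structure IsPrimitiveIdempotentOrdering {X : Type*} [Fintype X] [DecidableEq X]
    (Γ : SimpleGraph X) (E : Fin (Γ.diam + 1) → Matrix X X ℝ) : Prop where
  linearIndependent : LinearIndependent ℝ E
  span_eq : Submodule.span ℝ (Set.range E) = boseMesner Γ
  zero_eq : E 0 = (Fintype.card X : ℝ)⁻¹ • Matrix.of (fun _ _ => (1 : ℝ))
  sum_eq_one : ∑ i, E i = 1
  transpose_eq : ∀ i, (E i)ᵀ = E i
  mul_eq : ∀ i j, E i * E j = if i = j then E i else 0

/-- `q h i j` are coefficients with `E_i ∘ E_j = |X|⁻¹ ∑_h q^h_{i,j} E_h` for all `i, j`, where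
`∘` (written `⊙`) is the entrywise product. -/
def IsKrein {X : Type*} [Fintype X] {n : ℕ} (E : Fin n → Matrix X X ℝ)
    (q : Fin n → Fin n → Fin n → ℝ) : Prop :=
  ∀ i j, E i ⊙ E j = (Fintype.card X : ℝ)⁻¹ • ∑ h, q h i j • E h

open Classical in
/-- The Krein parameter `q^h_{i,j}` of an ordering `E` of the primitive idempotents. -/
noncomputable def krein {X : Type*} [Fintype X] {n : ℕ} (E : Fin n → Matrix X X ℝ)
    (h i j : Fin n) : ℝ :=
  if hq : ∃ q, IsKrein E q then hq.choose h i j else 0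

theorem hadamard_mem_boseMesner {X : Type*} (Γ : SimpleGraph X) {B C : Matrix X X ℝ}
    (hB : B ∈ boseMesner Γ) (hC : C ∈ boseMesner Γ) : B ⊙ C ∈ boseMesner Γ := by
  unfold boseMesner at hB hC
  induction hB using Submodule.span_induction with
  | zero => rw [Matrix.zero_hadamard]; exact Submodule.zero_mem _
  | add B B' _ _ h h' => rw [Matrix.add_hadamard]; exact Submodule.add_mem _ h h'
  | smul r B _ h => rw [Matrix.smul_hadamard]; exact Submodule.smul_mem _ r h
  | mem B hB =>
    obtain ⟨i, hi, rfl⟩ := hB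
    induction hC using Submodule.span_induction with
    | zero => rw [Matrix.hadamard_zero]; exact Submodule.zero_mem _
    | add C C' _ _ h h' => rw [Matrix.hadamard_add]; exact Submodule.add_mem _ h h'
    | smul r C _ h => rw [Matrix.hadamard_smul]; exact Submodule.smul_mem _ r h
    | mem C hC =>
      obtain ⟨j, hj, rfl⟩ := hC
      by_cases hij : i = j
      · subst hij
        refine Submodule.subset_span ⟨i, hi, ?_⟩
        ext x y
        simp [distanceMatrix]
      · have h0 : distanceMatrix Γ i ⊙ distanceMatrix Γ j = 0 := by
          ext x y
          simp only [distanceMatrix, Matrix.hadamard_apply, Matrix.of_apply, Matrix.zero_apply]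
          split_ifs with h1 h2
          · exact absurd (h1.symm.trans h2) hij
          all_goals simp
        rw [h0]
        exact Submodule.zero_mem _

/-- The Krein parameters satisfy their defining equations. -/
theorem isKrein_krein {X : Type*} [Fintype X] [DecidableEq X] {Γ : SimpleGraph X}
    {E : Fin (Γ.diam + 1) → Matrix X X ℝ} (hE : IsPrimitiveIdempotentOrdering Γ E) :
    IsKrein E (krein E) := by
  have hq : ∃ q, IsKrein E q := by
    have hmem : ∀ i, E i ∈ boseMesner Γ := fun i =>
      hE.span_eq ▸ Submodule.subset_span (Set.mem_range_self i)
    have hc : ∀ i j, ∃ c : Fin (Γ.diam + 1) → ℝ, ∑ h, c h • E h = E i ⊙ E j := fun i j =>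
      Submodule.mem_span_range_iff_exists_fun ℝ |>.1
        (hE.span_eq.symm ▸ hadamard_mem_boseMesner Γ (hmem i) (hmem j))
    choose c hc using hc
    refine ⟨fun h i j => (Fintype.card X : ℝ) * c i j h, fun i j => ?_⟩
    rcases isEmpty_or_nonempty X with hX | hX
    · ext x
      exact hX.elim x
    · have hX' : (Fintype.card X : ℝ) ≠ 0 := by exact_mod_cast Fintype.card_ne_zero
      simp only [mul_smul, ← Finset.smul_sum, hc]
      rw [inv_smul_smul₀ hX']
  have hk : krein E = hq.choose := by
    funext h i j
    rw [krein, dif_pos hq]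
  rw [hk]
  exact hq.choose_spec

/-- The Krein parameters are the only solution of their defining equations. -/
theorem krein_unique {X : Type*} [Fintype X] [DecidableEq X] [Nonempty X] {Γ : SimpleGraph X}
    {E : Fin (Γ.diam + 1) → Matrix X X ℝ} (hE : IsPrimitiveIdempotentOrdering Γ E)
    {q : Fin (Γ.diam + 1) → Fin (Γ.diam + 1) → Fin (Γ.diam + 1) → ℝ} (hq : IsKrein E q) :
    q = krein E := by
  have hX' : (Fintype.card X : ℝ)⁻¹ ≠ 0 :=
    inv_ne_zero (by exact_mod_cast Fintype.card_ne_zero)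
  funext h i j
  have h1 := smul_right_injective _ hX' ((hq i j).symm.trans (isKrein_krein hE i j))
  have h2 : ∑ h, (q h i j - krein E h i j) • E h = 0 := by
    simp only [sub_smul, Finset.sum_sub_distrib]
    exact sub_eq_zero.2 h1
  exact sub_eq_zero.1 (Fintype.linearIndependent_iff.1 hE.linearIndependent _ h2 h)

/-- A `Q`-polynomial ordering `E_0, …, E_D` of the primitive idempotents of `Γ`. -/
structure IsQPolynomialOrdering {X : Type*} [Fintype X] [DecidableEq X]
    (Γ : SimpleGraph X) (E : Fin (Γ.diam + 1) → Matrix X X ℝ) : Prop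
    extends IsPrimitiveIdempotentOrdering Γ E where
  krein_eq_zero : ∀ h i j : Fin (Γ.diam + 1),
    ((i : ℕ) + j < h ∨ (h : ℕ) + j < i ∨ (h : ℕ) + i < j) → krein E h i j = 0
  krein_ne_zero : ∀ h i j : Fin (Γ.diam + 1),
    ((h : ℕ) = i + j ∨ (i : ℕ) = h + j ∨ (j : ℕ) = h + i) → krein E h i j ≠ 0

/-- The dual intersection number `a*_i = q^i_{1,i}`. -/
noncomputable def aStar {X : Type*} [Fintype X] {n : ℕ} (E : Fin (n + 1) → Matrix X X ℝ)
    (i : Fin (n + 1)) : ℝ :=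
  krein E i 1 i

/-- `Γ` is tight (with respect to the `Q`-polynomial ordering `E`): `Γ` is not bipartite and
`a_D = a*_D = 0`. -/
def IsTight {X : Type*} [Fintype X] [DecidableEq X] (Γ : SimpleGraph X)
    (E : Fin (Γ.diam + 1) → Matrix X X ℝ) : Prop :=
  ¬ IsBipartite Γ ∧ a Γ Γ.diam = 0 ∧ aStar E (Fin.last Γ.diam) = 0

/-- The vector `E x̂`, where `x̂` is the standard basis vector at `x`. -/
def proj {X : Type*} [Fintype X] [DecidableEq X] (E : Matrix X X ℝ) (x : X) : X → ℝ :=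
  E *ᵥ Pi.single x 1

/-- The Norton product `u ⋆ v = E (u ∘ v)`, where `∘` is the entrywise product. -/
def nortonProduct {X : Type*} [Fintype X] (E : Matrix X X ℝ) (u v : X → ℝ) : X → ℝ :=
  E *ᵥ (fun x => u x * v x)

/-- The set `{E x̂ | x ∈ X}` is Norton-balanced. -/
def IsNortonBalanced {X : Type*} [Fintype X] [DecidableEq X] (Γ : SimpleGraph X)
    (E : Matrix X X ℝ) : Prop :=
  ∀ x y : X, ∀ i j : ℕ, i ≤ Γ.diam → j ≤ Γ.diam →
    ∑ z ∈ sphere Γ i x ∩ sphere Γ j y, proj E z ∈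
      Submodule.span ℝ {proj E x, proj E y, nortonProduct E (proj E x) (proj E y)}

end DRG

/-! Fix `x` and put `A*_i` for the diagonal matrix with entries `e i (d x z)`, the dual distance
matrix up to the factor `|X|`. Let `χ` be the indicator of `Γ_i(x) ∩ Γ_j(y)`. It suffices to find
`β, γ` for which `χ - β ŷ - γ (E x̂ ∘ E ŷ)` is orthogonal to enough of `EV`. The test vectors form
two families: the vectors of `EV` vanishing on `{x} ∪ Γ_1(x)`, and the vectors `E w` with `w` of
zero sum on `Γ_1(x)`. A vector of `EV` that vanishes at `x` and is orthogonal to both families is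
zero (`eq_zero_of_orthogonal`), so the error left after projecting to `EV` is a multiple of `E x̂`.

On each family both pairings are scalars times `v y`. A vector `v` of `EV` satisfies `E_l A*_i v =
0` unless `|l - i| ≤ 1`, by the vanishing Krein parameters. Vanishing at `x` and on a sphere
`Γ_i(x)` gives two linear relations among the `A*_j v`. Together they force every `E_l A*_i v` to be
`v` times a function of the distance to `x` (`exists_idem_mulVec_radialMul`). Hence `⟨χ, v⟩ = g · v
y`, and `⟨E x̂ ∘ E ŷ, v⟩ = (E A*_1 v) y` is a scalar times `v y`. The latter scalars differ for the
two families (`local_eigenvalue_ne`), so `β, γ` solve a 2 by 2 linear system.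

The first family vanishes on `Γ_1(x)`. That the second vanishes on `Γ_D(x)` is where `a_D = 0`
enters: it makes `E w` an eigenvector of `E A*_1 E`, and the norm of `E w` on `Γ_i(x)` then contains
the factor `θ*_i - θ*_D`, where `θ*_i` is proportional to `e 1 i`. Nonnegativity of these norms
makes `θ*_D` extreme among `θ*_1, …, θ*_D`. A tridiagonal quadratic form turns this into `p D j ≠ p
D (j + 1)`, which the two relations need (`isThinVector_idem_mulVec`). -/

namespace DRG

/-- The numerical data of a `Q`-polynomial distance-regular graph with `a_D = 0`: the primitive
idempotents have entries `e j (d x y)`, the distance matrices have eigenvalues `p i j`, and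
`q h j` are the Krein parameters `q^h_{1,j}`. -/
structure IsQData {X : Type*} [Fintype X] (d : X → X → ℕ) (D : ℕ) (e p q : ℕ → ℕ → ℝ) :
    Prop where
  three_le : 3 ≤ D
  dist_eq_zero : ∀ x y, d x y = 0 ↔ x = y
  dist_comm : ∀ x y, d x y = d y x
  dist_le : ∀ x y, d x y ≤ D
  exists_dist_eq : ∀ x, ∀ i ≤ D, ∃ z, d x z = i
  orth : ∀ i j x y, ∑ z, e i (d x z) * e j (d z y) = if i = j then e i (d x y) else 0
  pos : ∀ j ≤ D, 0 < e j 0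
  eq_zero : ∀ j, D < j → ∀ i, e j i = 0
  trivial : ∀ i ≤ D, e 0 i = (Fintype.card X : ℝ)⁻¹
  inversion : ∀ i ≤ D, ∀ l ≤ D,
    ∑ j ∈ Finset.range (D + 1), p i j * e j l = if l = i then 1 else 0
  krein : ∀ j ≤ D, ∀ l ≤ D,
    e 1 l * e j l = (Fintype.card X : ℝ)⁻¹ * ∑ h ∈ Finset.range (D + 1), q h j * e h l
  krein_eq_zero : ∀ h ≤ D, ∀ j ≤ D, (h + 1 < j ∨ j + 1 < h) → q h j = 0
  krein_ne_zero : ∀ j, j + 1 ≤ D → q (j + 1) j ≠ 0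
  eigenvalue_inj : ∀ j ≤ D, ∀ l ≤ D, p 1 j = p 1 l → j = l
  far : ∀ x y z, d x y = 1 → d x z = D → d y z = D - 1
  near : ∀ x y z, d x y = 1 → d y z = D → D - 1 ≤ d x z

/-- The matrix with entries `e j (d x y)`. -/
def idem {X : Type*} (d : X → X → ℕ) (e : ℕ → ℕ → ℝ) (j : ℕ) : Matrix X X ℝ :=
  Matrix.of fun x y => e j (d x y)

/-- The entrywise product of `v` with the function `z ↦ g (d x z)`. -/
def radialMul {X : Type*} (d : X → X → ℕ) (x : X) (g : ℕ → ℝ) (v : X → ℝ) : X → ℝ :=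
  fun z => g (d x z) * v z

/-! ### Krein conditions and triple products of idempotents -/

theorem sum_sq_triple {X : Type*} [Fintype X] (P Q R : X → X → ℝ) :
    ∑ a, ∑ b, ∑ c, (∑ z, P z a * Q z b * R z c) ^ 2 =
      ∑ z, ∑ w, (∑ a, P z a * P w a) * (∑ b, Q z b * Q w b) * (∑ c, R z c * R w c) := by
  have h1 : ∀ z w, (∑ a, P z a * P w a) * (∑ b, Q z b * Q w b) * (∑ c, R z c * R w c) =
      ∑ a, ∑ b, ∑ c, (P z a * Q z b * R z c) * (P w a * Q w b * R w c) := by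
    intro z w
    rw [Finset.sum_mul_sum, Finset.sum_mul]
    refine Finset.sum_congr rfl fun a _ => ?_
    rw [Finset.sum_mul_sum]
    refine Finset.sum_congr rfl fun b _ => Finset.sum_congr rfl fun c _ => ?_
    ring
  simp_rw [h1, sq, Finset.sum_mul_sum]
  have h2 : ∀ f : X → X → X → X → X → ℝ, ∑ a, ∑ b, ∑ c, ∑ z, ∑ w, f a b c z w =
      ∑ z, ∑ w, ∑ a, ∑ b, ∑ c, f a b c z w := by
    intro f
    simp_rw [← Fintype.sum_prod_type']
    refine Fintype.sum_equiv
      ⟨fun t => (t.2.2.2.1, t.2.2.2.2, t.1, t.2.1, t.2.2.1),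
        fun t => (t.2.2.1, t.2.2.2.1, t.2.2.2.2, t.1, t.2.1), fun _ => rfl, fun _ => rfl⟩ _ _ ?_
    intro t
    rfl
  exact h2 _

namespace IsQData

variable {X : Type*} [Fintype X] {d : X → X → ℕ} {D : ℕ} {e p q : ℕ → ℕ → ℝ}

theorem dist_self (H : IsQData d D e p q) (x : X) : d x x = 0 := (H.dist_eq_zero x x).2 rfl

theorem card_pos (_ : IsQData d D e p q) [Nonempty X] : 0 < (Fintype.card X : ℝ) := by
  exact_mod_cast Fintype.card_pos

theorem sum_triple (H : IsQData d D e p q) {j l : ℕ} (hj : j ≤ D) (hl : l ≤ D) (x : X) :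
    ∑ z, e 1 (d x z) * e j (d x z) * e l (d x z) =
      (Fintype.card X : ℝ)⁻¹ * q l j * e l 0 := by
  have h1 : ∀ z, e 1 (d x z) * e j (d x z) * e l (d x z) =
      ∑ h ∈ Finset.range (D + 1), (Fintype.card X : ℝ)⁻¹ * q h j *
        (e h (d x z) * e l (d z x)) := by
    intro z
    rw [H.krein j hj _ (H.dist_le x z), H.dist_comm z x, Finset.mul_sum, Finset.sum_mul]
    refine Finset.sum_congr rfl fun _ _ => by ring
  simp_rw [h1]
  rw [Finset.sum_comm]
  simp_rw [← Finset.mul_sum, H.orth, H.dist_self]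
  simp [Finset.sum_ite_eq', Nat.lt_succ_iff.2 hl]

theorem sum_mul_self (H : IsQData d D e p q) (j : ℕ) (x y : X) :
    ∑ z, e j (d x z) * e j (d y z) = e j (d x y) := by
  have h := H.orth j j x y
  rw [if_pos rfl] at h
  rw [← h]
  exact Finset.sum_congr rfl fun z _ => by rw [H.dist_comm z y]

/-- Writing a Krein parameter as a sum of squares gives its nonnegativity; when it is zero, every
triple product vanishes (`triple_eq_zero`). -/
theorem sum_sq_triple_eq [Nonempty X] (H : IsQData d D e p q) {j l : ℕ} (hj : j ≤ D) (hl : l ≤ D) :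
    ∑ a, ∑ b, ∑ c, (∑ z, e 1 (d z a) * e j (d z b) * e l (d z c)) ^ 2 = q l j * e l 0 := by
  rw [sum_sq_triple (fun z a => e 1 (d z a)) (fun z a => e j (d z a)) (fun z a => e l (d z a))]
  simp only [H.sum_mul_self]
  simp only [H.sum_triple hj hl]
  have := H.card_pos.ne'
  simp
  field_simp

theorem krein_nonneg [Nonempty X] (H : IsQData d D e p q) {j l : ℕ} (hj : j ≤ D) (hl : l ≤ D) :
    0 ≤ q l j := by
  have h := H.sum_sq_triple_eq hj hl
  have h0 : 0 ≤ q l j * e l 0 := by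
    rw [← h]
    exact Finset.sum_nonneg fun _ _ => Finset.sum_nonneg fun _ _ => Finset.sum_nonneg fun _ _ =>
      sq_nonneg _
  exact nonneg_of_mul_nonneg_left h0 (H.pos l hl)

theorem krein_succ_pos [Nonempty X] (H : IsQData d D e p q) {j : ℕ} (hj : j + 1 ≤ D) :
    0 < q (j + 1) j :=
  lt_of_le_of_ne (H.krein_nonneg (by lia) hj) (H.krein_ne_zero j hj).symm

theorem triple_eq_zero [Nonempty X] (H : IsQData d D e p q) {j l : ℕ}
    (h : l + 1 < j ∨ j + 1 < l) (a b c : X) :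
    ∑ z, e 1 (d z a) * e j (d z b) * e l (d z c) = 0 := by
  by_cases hj : D < j
  · simp [H.eq_zero j hj]
  by_cases hl : D < l
  · simp [H.eq_zero l hl]
  push Not at hj hl
  have h1 := H.sum_sq_triple_eq hj hl
  rw [H.krein_eq_zero l hl j hj h, zero_mul] at h1
  have n1 : ∀ a b, 0 ≤ ∑ c, (∑ z, e 1 (d z a) * e j (d z b) * e l (d z c)) ^ 2 := fun a b =>
    Finset.sum_nonneg fun _ _ => sq_nonneg _
  have n2 : ∀ a, 0 ≤ ∑ b, ∑ c, (∑ z, e 1 (d z a) * e j (d z b) * e l (d z c)) ^ 2 := fun a =>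
    Finset.sum_nonneg fun b _ => n1 a b
  have h2 := (Finset.sum_eq_zero_iff_of_nonneg fun a _ => n2 a).1 h1 a (Finset.mem_univ _)
  have h3 := (Finset.sum_eq_zero_iff_of_nonneg fun b _ => n1 a b).1 h2 b (Finset.mem_univ _)
  have h4 := (Finset.sum_eq_zero_iff_of_nonneg fun c _ => sq_nonneg _).1 h3 c (Finset.mem_univ _)
  exact pow_eq_zero_iff two_ne_zero |>.1 h4

theorem idem_apply_comm (H : IsQData d D e p q) (j : ℕ) (x y : X) :
    idem d e j x y = idem d e j y x := by
  simp [idem, H.dist_comm x y]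

theorem idem_transpose (H : IsQData d D e p q) (j : ℕ) : (idem d e j)ᵀ = idem d e j := by
  ext x y
  exact H.idem_apply_comm j y x

theorem idem_mul (H : IsQData d D e p q) (i j : ℕ) :
    idem d e i * idem d e j = if i = j then idem d e i else 0 := by
  ext x y
  rw [Matrix.mul_apply]
  simp only [idem, Matrix.of_apply, H.orth]
  split_ifs <;> simp

theorem idem_mulVec_idem_mulVec (H : IsQData d D e p q) (i j : ℕ) (v : X → ℝ) :
    idem d e i *ᵥ (idem d e j *ᵥ v) = if i = j then idem d e i *ᵥ v else 0 := by
  rw [Matrix.mulVec_mulVec, H.idem_mul]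
  split_ifs <;> simp

theorem dotProduct_idem_mulVec (H : IsQData d D e p q) (j : ℕ) (u v : X → ℝ) :
    u ⬝ᵥ (idem d e j *ᵥ v) = (idem d e j *ᵥ u) ⬝ᵥ v := by
  rw [Matrix.dotProduct_mulVec, ← Matrix.mulVec_transpose, H.idem_transpose]

theorem idem_eq_zero (H : IsQData d D e p q) {j : ℕ} (hj : D < j) : idem d e j = 0 := by
  ext x y
  simp [idem, H.eq_zero j hj]

/-- If `q^l_{1,j} = 0` then `E_l (E_1 u ∘ E_j v) = 0`. -/
theorem idem_mulVec_mul_eq_zero [Nonempty X] (H : IsQData d D e p q) {j l : ℕ}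
    (h : l + 1 < j ∨ j + 1 < l) (u v : X → ℝ) :
    idem d e l *ᵥ (fun z => (idem d e 1 *ᵥ u) z * (idem d e j *ᵥ v) z) = 0 := by
  funext c
  simp only [Matrix.mulVec, dotProduct, idem, Matrix.of_apply, Pi.zero_apply]
  simp_rw [Finset.sum_mul_sum, Finset.mul_sum]
  rw [Finset.sum_comm]
  refine Finset.sum_eq_zero fun a _ => ?_
  rw [Finset.sum_comm]
  refine Finset.sum_eq_zero fun b _ => ?_
  have h1 := H.triple_eq_zero h a b c
  calc _ = u a * v b * ∑ z, e 1 (d z a) * e j (d z b) * e l (d z c) := by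
        rw [Finset.mul_sum]
        refine Finset.sum_congr rfl fun z _ => ?_
        rw [H.dist_comm c z]
        ring
    _ = 0 := by rw [h1, mul_zero]

theorem idem_mulVec_single [DecidableEq X] (H : IsQData d D e p q) (j : ℕ) (x z : X) :
    (idem d e j *ᵥ Pi.single x 1) z = e j (d x z) := by
  simp [idem, H.dist_comm z x]

/-! ### Eigenvalues and entries of the idempotents -/

/-- The column sums over spheres: `A_i E_j = p_i(j) E_j`. -/
theorem sum_sphere (H : IsQData d D e p q) {i j : ℕ} (hi : i ≤ D) (hj : j ≤ D) (x y : X) :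
    ∑ z, (if d x z = i then e j (d z y) else 0) = p i j * e j (d x y) := by
  have h1 : ∀ z, (if d x z = i then e j (d z y) else 0) =
      ∑ l ∈ Finset.range (D + 1), p i l * (e l (d x z) * e j (d z y)) := by
    intro z
    have h := H.inversion i hi _ (H.dist_le x z)
    simp_rw [← mul_assoc]
    rw [← Finset.sum_mul, h]
    simp
  simp_rw [h1]
  rw [Finset.sum_comm]
  simp_rw [← Finset.mul_sum, H.orth]
  simp [Finset.sum_ite_eq', Nat.lt_succ_iff.2 hj]

theorem eigenvalue_zero_pos [Nonempty X] (H : IsQData d D e p q) {i : ℕ} (hi : i ≤ D) :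
    0 < p i 0 := by
  obtain ⟨x⟩ := ‹Nonempty X›
  have h := H.sum_sphere hi (Nat.zero_le D) x x
  have hc := H.pos 0 (Nat.zero_le _)
  have h0 : ∀ z, e 0 (d z x) = e 0 0 := fun z => by
    rw [H.trivial _ (H.dist_le z x), H.trivial 0 (Nat.zero_le _)]
  simp_rw [h0] at h
  obtain ⟨z, hz⟩ := H.exists_dist_eq x i hi
  have : 0 < ∑ z, (if d x z = i then e 0 0 else 0) :=
    Finset.sum_pos' (fun z _ => by split_ifs <;> simp [hc.le]) ⟨z, Finset.mem_univ _, by simp [hz, hc]⟩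
  rw [h] at this
  exact pos_of_mul_pos_left this hc.le

theorem eigenvalue_mul [Nonempty X] (H : IsQData d D e p q) {i j : ℕ} (hi : i ≤ D) (hj : j ≤ D) :
    p i j * e j 0 = p i 0 * e j i := by
  obtain ⟨x⟩ := ‹Nonempty X›
  have h := H.sum_sphere hi hj x x
  have hh := H.sum_sphere hi (Nat.zero_le D) x x
  have hc := H.pos 0 (Nat.zero_le _)
  have h0 : ∀ z, e 0 (d z x) = e 0 0 := fun z => by
    rw [H.trivial _ (H.dist_le z x), H.trivial 0 (Nat.zero_le _)]
  simp_rw [h0] at hh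
  rw [H.dist_self] at h
  have h1 : ∑ z, (if d x z = i then e j (d z x) else 0) = (∑ z, (if d x z = i then 1 else 0)) * e j i := by
    rw [Finset.sum_mul]
    refine Finset.sum_congr rfl fun z _ => ?_
    by_cases hz : d x z = i
    · simp [hz, H.dist_comm z x]
    · simp [hz]
  have h2 : ∑ z, (if d x z = i then e 0 0 else 0) = (∑ z, (if d x z = i then (1:ℝ) else 0)) * e 0 0 := by
    rw [Finset.sum_mul]
    refine Finset.sum_congr rfl fun z _ => by simp
  rw [← h, h1, mul_right_cancel₀ hc.ne' (h2.symm.trans hh)]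

theorem eigenvalue_dist_zero [Nonempty X] (H : IsQData d D e p q) {j : ℕ} (hj : j ≤ D) :
    p 0 j = 1 := by
  obtain ⟨x⟩ := ‹Nonempty X›
  have h := H.sum_sphere (Nat.zero_le D) hj x x
  have h1 : ∑ z, (if d x z = 0 then e j (d z x) else 0) = e j 0 := by
    rw [Finset.sum_eq_single x]
    · simp [H.dist_self]
    · intro z _ hz
      rw [if_neg fun h0 => hz ((H.dist_eq_zero x z).1 h0).symm]
    · simp
  rw [h1, H.dist_self] at h
  exact (mul_eq_right₀ (H.pos j hj).ne').1 h.symm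

theorem sum_entries [Nonempty X] (H : IsQData d D e p q) {l : ℕ} (hl : l ≤ D) :
    ∑ j ∈ Finset.range (D + 1), e j l = if l = 0 then 1 else 0 := by
  rw [← H.inversion 0 (Nat.zero_le _) l hl]
  refine Finset.sum_congr rfl fun j hj => ?_
  rw [H.eigenvalue_dist_zero (Nat.lt_succ_iff.1 (Finset.mem_range.1 hj)), one_mul]

theorem sum_idem_mulVec [Nonempty X] (H : IsQData d D e p q) (v : X → ℝ) :
    ∑ j ∈ Finset.range (D + 1), idem d e j *ᵥ v = v := by
  classical
  funext x
  simp only [Finset.sum_apply, Matrix.mulVec, dotProduct, idem, Matrix.of_apply]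
  rw [Finset.sum_comm]
  simp_rw [← Finset.sum_mul, H.sum_entries (H.dist_le _ _), H.dist_eq_zero]
  simp

/-- The Krein recurrence makes `e j t` a polynomial in `e 1 t`. If `e 1` agreed at two distances,
every `e j` would, contrary to the invertibility of the matrix of the `e j t`. -/
theorem entry_one_injOn [Nonempty X] (H : IsQData d D e p q) {i l : ℕ} (hi : i ≤ D) (hl : l ≤ D)
    (h : e 1 i = e 1 l) : i = l := by
  have hall : ∀ j, j ≤ D → e j i = e j l := by
    intro j
    induction j using Nat.strong_induction_on with
    | _ j ih =>
      intro hj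
      rcases j with _ | j
      · rw [H.trivial i hi, H.trivial l hl]
      have hjD : j + 1 < D + 1 := by lia
      have key : ∀ t ≤ D, (Fintype.card X : ℝ)⁻¹ * (q (j + 1) j * e (j + 1) t) =
          e 1 t * e j t - (Fintype.card X : ℝ)⁻¹ * ∑ h ∈ Finset.range (j + 1), q h j * e h t := by
        intro t ht
        rw [H.krein j (by lia) t ht]
        have : ∑ h ∈ Finset.range (D + 1), q h j * e h t =
            ∑ h ∈ Finset.range (j + 2), q h j * e h t := by
          symm
          refine Finset.sum_subset (Finset.range_subset_range.2 (by lia)) fun h h1 h2 => ?_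
          rw [Finset.mem_range] at h1 h2
          rw [H.krein_eq_zero h (by lia) j (by lia) (by lia), zero_mul]
        rw [this, Finset.sum_range_succ]
        ring
      have h1 := key i hi
      have h2 : ∑ h ∈ Finset.range (j + 1), q h j * e h i =
          ∑ h ∈ Finset.range (j + 1), q h j * e h l := by
        refine Finset.sum_congr rfl fun t ht => ?_
        rw [ih t (Finset.mem_range.1 ht) (by have := Finset.mem_range.1 ht; lia)]
      rw [h, ih j (by lia) (by lia), h2, ← key l hl] at h1
      have := H.card_pos.ne'
      exact mul_left_cancel₀ (H.krein_ne_zero j hj) (mul_left_cancel₀ (inv_ne_zero this) h1)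
  have h1 := H.inversion i hi i hi
  have h2 := H.inversion i hi l hl
  rw [Finset.sum_congr rfl fun j hj => by
    rw [hall j (Nat.lt_succ_iff.1 (Finset.mem_range.1 hj))], h2] at h1
  by_contra hne
  rw [if_neg (Ne.symm hne)] at h1
  simp at h1

end IsQData
-- Thin vectors and their three-term relations
theorem sum_range_eq_three {g : ℕ → ℝ} {n D : ℕ} (h : ∀ i, i ≠ n → i ≠ n + 1 → i ≠ n + 2 → g i = 0)
    (hD : ∀ i, D < i → g i = 0) :
    ∑ i ∈ Finset.range (D + 1), g i = g n + g (n + 1) + g (n + 2) := by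
  have h1 : ∑ i ∈ Finset.range (D + 1), g i = ∑ i ∈ Finset.range (D + n + 3), g i :=
    Finset.sum_subset (Finset.range_subset_range.2 (by lia)) fun i _ hi =>
      hD i (by rw [Finset.mem_range] at hi; lia)
  have h2 : ∑ i ∈ Finset.Ico n (n + 3), g i = ∑ i ∈ Finset.range (D + n + 3), g i :=
    Finset.sum_subset (fun i hi => by rw [Finset.mem_Ico] at hi; rw [Finset.mem_range]; lia)
      fun i _ hi => h i (by rintro rfl; exact hi (by simp)) (by rintro rfl; exact hi (by simp))
        (by rintro rfl; exact hi (by simp))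
  rw [h1, ← h2]
  simp [Finset.sum_Ico_succ_top]

/-- `v` is a vector of `E_1 V` vanishing at `x` that is annihilated by `∑ f_i A*_i(x)`. -/
structure IsThinVector {X : Type*} [Fintype X] (d : X → X → ℕ) (D : ℕ) (e : ℕ → ℕ → ℝ) (x : X)
    (f : ℕ → ℝ) (v : X → ℝ) : Prop where
  idem_mulVec : idem d e 1 *ᵥ v = v
  apply_self : v x = 0
  sum_eq_zero : ∀ z, (∑ i ∈ Finset.range (D + 1), f i * e i (d x z)) * v z = 0

namespace IsQData

variable {X : Type*} [Fintype X] {d : X → X → ℕ} {D : ℕ} {e p q : ℕ → ℕ → ℝ}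

theorem idem_mulVec_radialMul_eq_zero [Nonempty X] (H : IsQData d D e p q) {i l : ℕ}
    (h : l + 1 < i ∨ i + 1 < l) {v : X → ℝ} (hv : idem d e 1 *ᵥ v = v) (x : X) :
    idem d e l *ᵥ radialMul d x (e i) v = 0 := by
  classical
  rw [← H.idem_mulVec_mul_eq_zero h v (Pi.single x 1), hv]
  congr 1
  funext z
  rw [H.idem_mulVec_single, radialMul, mul_comm]

theorem idem_zero_mulVec [Nonempty X] (H : IsQData d D e p q) (w : X → ℝ) (z : X) :
    (idem d e 0 *ᵥ w) z = (Fintype.card X : ℝ)⁻¹ * ∑ y, w y := by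
  simp only [Matrix.mulVec, dotProduct, idem, Matrix.of_apply, Finset.mul_sum]
  exact Finset.sum_congr rfl fun y _ => by rw [H.trivial _ (H.dist_le z y)]

theorem idem_zero_mulVec_radialMul [Nonempty X] (H : IsQData d D e p q) (i : ℕ)
    {v : X → ℝ} (hv : idem d e 1 *ᵥ v = v) {x : X} (hx : v x = 0) :
    idem d e 0 *ᵥ radialMul d x (e i) v = 0 := by
  funext z
  rw [H.idem_zero_mulVec]
  have h : ∑ y, radialMul d x (e i) v y = (idem d e i *ᵥ v) x := by
    simp [Matrix.mulVec, dotProduct, idem, radialMul]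
  rw [h, ← hv, H.idem_mulVec_idem_mulVec]
  split_ifs with hi
  · subst hi
    rw [hv, hx]; simp
  · simp

theorem radialMul_zero (H : IsQData d D e p q) (x : X) (v : X → ℝ) :
    radialMul d x (e 0) v = (Fintype.card X : ℝ)⁻¹ • v := by
  funext z
  simp [radialMul, H.trivial _ (H.dist_le x z)]

/-- Apply `E_{n+1}` to `∑ f_i A*_i v = 0`; only the indices within 1 of `n + 1` survive. -/
theorem three_term [Nonempty X] (H : IsQData d D e p q) {x : X} {f : ℕ → ℝ} {v : X → ℝ}
    (hv : IsThinVector d D e x f v) (n : ℕ) (z : X) :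
    f n * (idem d e (n + 1) *ᵥ radialMul d x (e n) v) z +
      f (n + 1) * (idem d e (n + 1) *ᵥ radialMul d x (e (n + 1)) v) z +
      f (n + 2) * (idem d e (n + 1) *ᵥ radialMul d x (e (n + 2)) v) z = 0 := by
  rw [← sum_range_eq_three (D := D)
    (g := fun i => f i * (idem d e (n + 1) *ᵥ radialMul d x (e i) v) z)]
  · simp only [Matrix.mulVec, dotProduct, Finset.mul_sum]
    rw [Finset.sum_comm]
    refine Finset.sum_eq_zero fun y _ => ?_
    have h := hv.sum_eq_zero y
    calc _ = idem d e (n + 1) z y *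
          ((∑ i ∈ Finset.range (D + 1), f i * e i (d x y)) * v y) := by
          rw [Finset.sum_mul, Finset.mul_sum]
          refine Finset.sum_congr rfl fun i _ => ?_
          simp only [radialMul]
          ring
      _ = 0 := by rw [h, mul_zero]
  · intro i h0 h1 h2
    rw [H.idem_mulVec_radialMul_eq_zero (by lia) hv.idem_mulVec x]
    simp
  · intro i hi
    have : radialMul d x (e i) v = 0 := by
      funext y
      simp [radialMul, H.eq_zero i hi]
    simp [this]

theorem IsThinVector.one [Nonempty X] (H : IsQData d D e p q) {x : X} {f : ℕ → ℝ} {v : X → ℝ}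
    (hv : IsThinVector d D e x f v) : IsThinVector d D e x 1 v where
  idem_mulVec := hv.idem_mulVec
  apply_self := hv.apply_self
  sum_eq_zero z := by
    simp only [Pi.one_apply, one_mul, H.sum_entries (H.dist_le x z)]
    by_cases hz : d x z = 0
    · rw [← (H.dist_eq_zero x z).1 hz, hv.apply_self, mul_zero]
    · simp [hz]

/-- `E_j` maps the radial multiples of a thin vector to radial multiples of it, uniformly over the
thin vectors. -/
theorem exists_idem_mulVec_radialMul [Nonempty X] (H : IsQData d D e p q) {f : ℕ → ℝ}
    (hf : ∀ j, 1 ≤ j → j + 1 ≤ D → f j ≠ f (j + 1)) (x : X) (j : ℕ) :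
    ∀ i, ∃ G : ℕ → ℝ, ∀ v, IsThinVector d D e x f v →
      idem d e j *ᵥ radialMul d x (e i) v = radialMul d x G v := by
  induction j using Nat.strong_induction_on with
  | _ j ih =>
    intro i
    rcases j with _ | n
    · refine ⟨0, fun v hv => ?_⟩
      rw [H.idem_zero_mulVec_radialMul i hv.idem_mulVec hv.apply_self]
      funext z
      simp [radialMul]
    by_cases hn : D < n + 1
    · refine ⟨0, fun v _ => ?_⟩
      rw [H.idem_eq_zero hn]
      funext z
      simp [radialMul]
    -- The zero function for `l ≥ n + 1` only makes the choice total.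
    have ih' : ∀ l, ∃ G : ℕ → ℝ, l < n + 1 → ∀ v, IsThinVector d D e x f v →
        idem d e l *ᵥ radialMul d x (e n) v = radialMul d x G v := by
      intro l
      by_cases hl : l < n + 1
      · obtain ⟨G, hG⟩ := ih l hl n
        exact ⟨G, fun _ => hG⟩
      · exact ⟨0, fun h => absurd h hl⟩
    choose G hG using ih'
    obtain ⟨B, hB⟩ : ∃ B : ℕ → ℝ, ∀ v, IsThinVector d D e x f v →
        ∀ z, (idem d e (n + 1) *ᵥ radialMul d x (e n) v) z = B (d x z) * v z := by
      -- `A*_n v` is the sum of its components `E_l A*_n v` with `l ≤ n + 1`; those with `l ≤ n` are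
      -- radial by induction, hence so is the last.
      refine ⟨fun t => e n t - ∑ l ∈ Finset.range (n + 1), G l t, fun v hv z => ?_⟩
      have h1 := congrFun (H.sum_idem_mulVec (radialMul d x (e n) v)) z
      have h2 : ∑ j ∈ Finset.range (D + 1), idem d e j *ᵥ radialMul d x (e n) v =
          ∑ j ∈ Finset.range (n + 2), idem d e j *ᵥ radialMul d x (e n) v := by
        symm
        refine Finset.sum_subset (Finset.range_subset_range.2 (by lia)) fun h _ h2 => ?_
        rw [Finset.mem_range] at h2
        exact H.idem_mulVec_radialMul_eq_zero (by lia) hv.idem_mulVec x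
      rw [h2, Finset.sum_range_succ, Finset.sum_congr rfl fun l hl =>
        hG l (Finset.mem_range.1 hl) v hv] at h1
      simp only [Pi.add_apply, Finset.sum_apply, radialMul] at h1
      rw [sub_mul, Finset.sum_mul]
      linarith
    have h1 : ∀ v, IsThinVector d D e x f v → ∀ z,
        (idem d e (n + 1) *ᵥ radialMul d x (e n) v) z +
          (idem d e (n + 1) *ᵥ radialMul d x (e (n + 1)) v) z +
          (idem d e (n + 1) *ᵥ radialMul d x (e (n + 2)) v) z = 0 := by
      intro v hv z
      simpa using H.three_term (IsThinVector.one H hv) n z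
    have h2 : ∃ C : ℝ, ∀ v, IsThinVector d D e x f v → ∀ z,
        (idem d e (n + 1) *ᵥ radialMul d x (e (n + 2)) v) z =
          C * (idem d e (n + 1) *ᵥ radialMul d x (e n) v) z := by
      by_cases hD : n + 2 ≤ D
      -- Eliminate the middle term between the relation for `f` and the relation for the constant 1.
      · refine ⟨(f n - f (n + 1)) / (f (n + 1) - f (n + 2)), fun v hv z => ?_⟩
        have h3 := H.three_term hv n z
        have h4 := h1 v hv z
        have h5 : f (n + 1) - f (n + 2) ≠ 0 := sub_ne_zero.2 (hf (n + 1) (by lia) hD)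
        field_simp
        linear_combination f (n + 1) * h4 - h3
      · refine ⟨0, fun v _ z => ?_⟩
        have : radialMul d x (e (n + 2)) v = 0 := by
          funext y
          simp [radialMul, H.eq_zero (n + 2) (by lia)]
        simp [this]
    obtain ⟨C, hC⟩ := h2
    by_cases h0 : i = n
    · subst h0
      exact ⟨B, fun v hv => funext fun z => hB v hv z⟩
    by_cases h0 : i = n + 1
    · subst h0
      refine ⟨fun t => -(1 + C) * B t, fun v hv => funext fun z => ?_⟩
      have := h1 v hv z
      rw [hC v hv z, hB v hv z] at this
      simp only [radialMul] at this ⊢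
      linear_combination this
    by_cases h0 : i = n + 2
    · subst h0
      refine ⟨fun t => C * B t, fun v hv => funext fun z => ?_⟩
      rw [hC v hv z, hB v hv z]
      simp only [radialMul]
      ring
    · refine ⟨0, fun v hv => ?_⟩
      rw [H.idem_mulVec_radialMul_eq_zero (by lia) hv.idem_mulVec x]
      funext z
      simp [radialMul]

/-- By inversion, both sphere indicators are combinations of idempotent entries, so the sum is a
combination of the values `(E_l A*_k v) y`. -/
theorem exists_sum_inter [Nonempty X] (H : IsQData d D e p q) {f : ℕ → ℝ}
    (hf : ∀ j, 1 ≤ j → j + 1 ≤ D → f j ≠ f (j + 1)) (x y : X) {i j : ℕ} (hi : i ≤ D)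
    (hj : j ≤ D) :
    ∃ g : ℝ, ∀ v, IsThinVector d D e x f v →
      ∑ z, (if d x z = i ∧ d y z = j then v z else 0) = g * v y := by
  choose G hG using H.exists_idem_mulVec_radialMul hf x
  refine ⟨∑ l ∈ Finset.range (D + 1), ∑ k ∈ Finset.range (D + 1),
    p j l * p i k * G l k (d x y), fun v hv => ?_⟩
  have h1 : ∀ z, (if d x z = i ∧ d y z = j then v z else 0) =
      ∑ l ∈ Finset.range (D + 1), ∑ k ∈ Finset.range (D + 1),
        p j l * p i k * (e l (d y z) * (e k (d x z) * v z)) := by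
    intro z
    have h2 := H.inversion i hi _ (H.dist_le x z)
    have h3 := H.inversion j hj _ (H.dist_le y z)
    calc _ = (if d y z = j then 1 else 0) * (if d x z = i then 1 else 0) * v z := by
          split_ifs <;> simp_all
      _ = _ := by
          rw [← h2, ← h3, Finset.sum_mul_sum, Finset.sum_mul]
          refine Finset.sum_congr rfl fun l _ => ?_
          rw [Finset.sum_mul]
          refine Finset.sum_congr rfl fun k _ => ?_
          ring
  simp_rw [h1]
  rw [Finset.sum_comm, Finset.sum_mul]
  refine Finset.sum_congr rfl fun l _ => ?_
  rw [Finset.sum_comm, Finset.sum_mul]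
  refine Finset.sum_congr rfl fun k _ => ?_
  rw [← Finset.mul_sum, mul_assoc]
  have h4 := congrFun (hG l k v hv) y
  simp only [Matrix.mulVec, dotProduct, radialMul, idem, Matrix.of_apply] at h4
  rw [h4]
  ring

/-- The row `n = 0` of the relations for `f` and for 1, with the `A*_2` term eliminated. -/
theorem local_eigenvalue [Nonempty X] (H : IsQData d D e p q) {x : X} {f : ℕ → ℝ} {v : X → ℝ}
    (hv : IsThinVector d D e x f v) (z : X) :
    (f 1 - f 2) * (idem d e 1 *ᵥ radialMul d x (e 1) v) z =
      (f 2 - f 0) * ((Fintype.card X : ℝ)⁻¹ * v z) := by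
  have h1 := H.three_term (IsThinVector.one H hv) 0 z
  have h2 := H.three_term hv 0 z
  rw [H.radialMul_zero, Matrix.mulVec_smul, hv.idem_mulVec] at h1 h2
  simp only [Pi.one_apply, Pi.smul_apply, smul_eq_mul, zero_add, one_mul] at h1 h2
  linear_combination h2 - f 2 * h1

end IsQData
-- Cosines and the local eigenvalue at `x`
theorem local_eigenvalue_identity {m a b s r s' r' lam : ℝ} (hm : m = 1 + a + b)
    (hs : m * s ^ 2 = 1 + a * s + b * s') (hr : m * r ^ 2 = 1 + a * r + b * r')
    (hsr : m * (s * r) ^ 2 = 1 + a * (s * r) + b * (s' * r')) (hs1 : s ≠ 1) (hr1 : r ≠ 1)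
    (hl : lam * (r - r') = m * s * (r ^ 2 - r')) :
    b + (1 + lam) * (1 + m * r) = 0 := by
  -- Multiplying `hsr` by `b` lets `hs` and `hr` eliminate `s'` and `r'`; below, `hr` likewise
  -- removes `r'` from `hl`.
  have h1 : (s - 1) * (r - 1) * (m * (1 + s) * (1 + r) - a * (1 - m * s * r)) = 0 := by
    subst hm
    linear_combination (b * r') * hs + ((1 + a + b) * s ^ 2 - 1 - a * s) * hr - b * hsr
  have h2 : m * (1 + s) * (1 + r) - a * (1 - m * s * r) = 0 := by
    rcases mul_eq_zero.1 h1 with h | h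
    · rcases mul_eq_zero.1 h with h | h
      · exact absurd (sub_eq_zero.1 h) hs1
      · exact absurd (sub_eq_zero.1 h) hr1
    · exact h
  have h3 : (1 - r) * (lam * (1 + m * r) - m * s * (1 + (1 + a) * r)) = 0 := by
    subst hm
    linear_combination b * hl + ((1 + a + b) * s - lam) * hr
  have h4 : lam * (1 + m * r) - m * s * (1 + (1 + a) * r) = 0 :=
    (mul_eq_zero.1 h3).resolve_left fun h => hr1 (sub_eq_zero.1 h).symm
  linear_combination h4 + h2 - hm

/-- The `i`th entry of the cosine sequence of `E_j`. -/
noncomputable def cosine (e : ℕ → ℕ → ℝ) (j i : ℕ) : ℝ := e j i / e j 0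

namespace IsQData

variable {X : Type*} [Fintype X] {d : X → X → ℕ} {D : ℕ} {e p q : ℕ → ℕ → ℝ}

theorem entry_eq (H : IsQData d D e p q) {j : ℕ} (hj : j ≤ D) (i : ℕ) :
    e j i = e j 0 * cosine e j i := by
  rw [cosine, mul_div_cancel₀ _ (H.pos j hj).ne']

theorem eigenvalue_eq [Nonempty X] (H : IsQData d D e p q) {i j : ℕ} (hi : i ≤ D) (hj : j ≤ D) :
    p i j = p i 0 * cosine e j i := by
  rw [cosine, mul_div_assoc', ← H.eigenvalue_mul hi hj, mul_div_cancel_right₀ _ (H.pos j hj).ne']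

theorem cosine_zero (H : IsQData d D e p q) {j : ℕ} (hj : j ≤ D) : cosine e j 0 = 1 :=
  div_self (H.pos j hj).ne'

theorem sum_sphere_const [Nonempty X] (H : IsQData d D e p q) {i : ℕ} (hi : i ≤ D) (x : X)
    (c : ℝ) : ∑ z, (if d x z = i then c else 0) = p i 0 * c := by
  have h := H.sum_sphere hi (Nat.zero_le D) x x
  have hc := (H.pos 0 (Nat.zero_le _)).ne'
  have h0 : ∀ y z, e 0 (d z y) = e 0 0 := fun y z => by
    rw [H.trivial _ (H.dist_le z y), H.trivial 0 (Nat.zero_le _)]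
  simp_rw [h0] at h
  have h1 : ∀ b : ℝ, ∑ z, (if d x z = i then b else 0) =
      (∑ z, (if d x z = i then (1 : ℝ) else 0)) * b := fun b => by
    rw [Finset.sum_mul]
    exact Finset.sum_congr rfl fun z _ => by simp
  rw [h1] at h ⊢
  rw [mul_right_cancel₀ hc h]

theorem entry_one_lt [Nonempty X] (H : IsQData d D e p q) {i : ℕ} (hi : i ≤ D) (h0 : i ≠ 0) :
    e 1 i < e 1 0 := by
  obtain ⟨x⟩ := ‹Nonempty X›
  obtain ⟨y, rfl⟩ := H.exists_dist_eq x i hi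
  refine lt_of_le_of_ne ?_ fun h => h0 (H.entry_one_injOn hi (Nat.zero_le _) h)
  have h1 := H.sum_mul_self 1 x y
  have h2 := H.sum_mul_self 1 x x
  have h3 := H.sum_mul_self 1 y y
  rw [H.dist_self] at h2 h3
  have h4 : ∑ z, (2 * (e 1 (d x z) * e 1 (d y z))) ≤
      ∑ z, (e 1 (d x z) * e 1 (d x z) + e 1 (d y z) * e 1 (d y z)) :=
    Finset.sum_le_sum fun z _ => by nlinarith [sq_nonneg (e 1 (d x z) - e 1 (d y z))]
  rw [← Finset.mul_sum, Finset.sum_add_distrib, h1, h2, h3] at h4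
  linarith

theorem one_le (H : IsQData d D e p q) : 1 ≤ D := le_trans (by norm_num) H.three_le

theorem two_le (H : IsQData d D e p q) : 2 ≤ D := le_trans (by norm_num) H.three_le

theorem cosine_one_lt [Nonempty X] (H : IsQData d D e p q) {i : ℕ} (hi : i ≤ D) (h0 : i ≠ 0) :
    cosine e 1 i < 1 := by
  rw [cosine, div_lt_one (H.pos 1 H.one_le)]
  exact H.entry_one_lt hi h0

/-- The expansion of `E_1 ∘ E_1`, normalised so that cosines are 1 at distance 0. It expresses the
second cosine through the first. -/
theorem exists_quadratic [Nonempty X] (H : IsQData d D e p q) :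
    ∃ a b : ℝ, 0 < b ∧ (Fintype.card X : ℝ) * e 1 0 = 1 + a + b ∧ ∀ l ≤ D,
      (Fintype.card X : ℝ) * e 1 0 * cosine e 1 l ^ 2 =
        1 + a * cosine e 1 l + b * cosine e 2 l := by
  have hN := H.card_pos
  have h1 := H.pos 1 H.one_le
  have h2 := H.pos 2 H.two_le
  have hq0 : q 0 1 = (Fintype.card X : ℝ) * e 1 0 := by
    obtain ⟨x⟩ := ‹Nonempty X›
    have h := H.sum_triple H.one_le (Nat.zero_le D) x
    simp_rw [H.trivial _ (H.dist_le x _)] at h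
    rw [H.trivial 0 (Nat.zero_le D), ← Finset.sum_mul, H.sum_mul_self, H.dist_self] at h
    field_simp at h
    linarith
  have key : ∀ l ≤ D, (Fintype.card X : ℝ) * e 1 0 * cosine e 1 l ^ 2 =
        1 + q 1 1 * cosine e 1 l + (q 2 1 * e 2 0 / e 1 0) * cosine e 2 l := by
    intro l hl
    have h := H.krein 1 H.one_le l hl
    rw [sum_range_eq_three (n := 0)] at h
    · simp only [zero_add] at h
      rw [hq0, H.trivial l hl, H.entry_eq H.one_le l, H.entry_eq H.two_le l] at h
      field_simp at h
      field_simp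
      linear_combination h
    · intro i h0 h1 h2
      by_cases hi : i ≤ D
      · rw [H.krein_eq_zero i hi 1 H.one_le (by lia), zero_mul]
      · rw [H.eq_zero i (by lia), mul_zero]
    · intro i hi
      rw [H.eq_zero i hi, mul_zero]
  refine ⟨q 1 1, q 2 1 * e 2 0 / e 1 0, ?_, ?_, key⟩
  · have := H.krein_succ_pos (j := 1) H.two_le
    positivity
  · have := key 0 (Nat.zero_le _)
    rw [H.cosine_zero H.one_le, H.cosine_zero H.two_le] at this
    linarith

/-- If `d x z = D`, then by `far` every neighbour of `x` is at distance `D - 1` from `z`, so the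
eigenvalue equation of `A_1` has a single term. -/
theorem cosine_pred [Nonempty X] (H : IsQData d D e p q) {j : ℕ} (hj : j ≤ D) :
    cosine e j (D - 1) = cosine e j 1 * cosine e j D := by
  obtain ⟨x⟩ := ‹Nonempty X›
  obtain ⟨z, hz⟩ := H.exists_dist_eq x D le_rfl
  have h := H.sum_sphere H.one_le hj x z
  have h1 : ∀ y, (if d x y = 1 then e j (d y z) else 0) =
      if d x y = 1 then e j (D - 1) else 0 := by
    intro y
    split_ifs with hy
    · rw [H.far x y z hy hz]
    · rfl
  simp_rw [h1] at h
  rw [H.sum_sphere_const H.one_le, hz, H.eigenvalue_eq H.one_le hj, H.entry_eq hj (D - 1),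
    H.entry_eq hj D] at h
  have hp := H.eigenvalue_zero_pos H.one_le
  have he := H.pos j hj
  have h2 : p 1 0 * e j 0 * (cosine e j (D - 1)) =
      p 1 0 * e j 0 * (cosine e j 1 * cosine e j D) := by
    linear_combination h
  exact mul_left_cancel₀ (mul_pos hp he).ne' h2

theorem isThinVector_of_vanishing (H : IsQData d D e p q) {x : X} {v : X → ℝ} {i : ℕ}
    (hi : i ≤ D) (h1 : idem d e 1 *ᵥ v = v) (hx : v x = 0) (hv : ∀ z, d x z = i → v z = 0) :
    IsThinVector d D e x (p i) v where
  idem_mulVec := h1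
  apply_self := hx
  sum_eq_zero z := by
    rw [H.inversion i hi _ (H.dist_le x z)]
    split_ifs with h
    · rw [hv z h, mul_zero]
    · rw [zero_mul]

/-- For `w` supported on the neighbours of `x` with zero sum, `E_1 w` is an eigenvector of
`E_1 A*_1(x) E_1`. -/
theorem local_eigenvector [Nonempty X] (H : IsQData d D e p q) {x : X} {w : X → ℝ}
    (hw : ∀ z, d x z ≠ 1 → w z = 0) (hs : ∑ z, w z = 0) (z : X) :
    (p D 1 - p D 2) * (idem d e 1 *ᵥ radialMul d x (e 1) (idem d e 1 *ᵥ w)) z =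
      (e 1 (D - 1) * p D 1 - p D 2 * e 1 1) * (idem d e 1 *ᵥ w) z := by
  classical
  set a : ℕ → ℝ := fun j => (idem d e 1 *ᵥ radialMul d x (e 1) (idem d e j *ᵥ w)) z with ha
  -- Only the components `E_1 w` and `E_2 w` contribute: `E_0 w = 0` since `w` has zero sum, and
  -- `E_1 A*_1 E_j = 0` for `j > 2`. Taking `c = 1` and `c = p D` gives two equations for `a 1` and
  -- `a 2`.
  have hlin : ∀ c : ℕ → ℝ, (idem d e 1 *ᵥ radialMul d x (e 1)
      (∑ j ∈ Finset.range (D + 1), c j • (idem d e j *ᵥ w))) z = c 1 * a 1 + c 2 * a 2 := by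
    intro c
    have h1 : radialMul d x (e 1) (∑ j ∈ Finset.range (D + 1), c j • (idem d e j *ᵥ w)) =
        ∑ j ∈ Finset.range (D + 1), c j • radialMul d x (e 1) (idem d e j *ᵥ w) := by
      funext y
      simp only [radialMul, Finset.sum_apply, Pi.smul_apply, smul_eq_mul, Finset.mul_sum]
      exact Finset.sum_congr rfl fun _ _ => by ring
    rw [h1, Matrix.mulVec_sum, Finset.sum_apply]
    simp_rw [Matrix.mulVec_smul, Pi.smul_apply, smul_eq_mul]
    have h0 : a 0 = 0 := by
      have : idem d e 0 *ᵥ w = 0 := by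
        funext y
        rw [H.idem_zero_mulVec, hs, mul_zero]; rfl
      have h2 : radialMul d x (e 1) (0 : X → ℝ) = 0 := by
        funext y
        simp [radialMul]
      simp [ha, this, h2]
    have h3 : ∀ j, 2 < j → a j = 0 := by
      intro j hj
      have := H.idem_mulVec_mul_eq_zero (j := j) (l := 1) (by lia) (Pi.single x 1) w
      simp_rw [H.idem_mulVec_single] at this
      exact congrFun this z
    rw [sum_range_eq_three (n := 0) (g := fun j => c j * a j)]
    · simp [h0]
    · intro i _ _ _
      rw [h3 i (by lia), mul_zero]
    · intro i hi
      rw [h3 i (by have := H.three_le; lia), mul_zero]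
  have h1 : a 1 + a 2 = e 1 1 * (idem d e 1 *ᵥ w) z := by
    have h := hlin 1
    simp only [Pi.one_apply, one_smul, H.sum_idem_mulVec, one_mul] at h
    have h2 : radialMul d x (e 1) w = e 1 1 • w := by
      funext y
      by_cases hy : d x y = 1
      · simp [radialMul, hy]
      · simp [radialMul, hw y hy]
    rw [← h, h2, Matrix.mulVec_smul]
    rfl
  have h2 : p D 1 * a 1 + p D 2 * a 2 = e 1 (D - 1) * (p D 1 * (idem d e 1 *ᵥ w) z) := by
    rw [← hlin (p D)]
    -- The sum is `A_D w`. It is supported on `Γ_{D-1}(x)`, by `near` and `far`, so `A*_1` acts on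
    -- it as the scalar `e 1 (D - 1)`.
    have h3 : radialMul d x (e 1) (∑ j ∈ Finset.range (D + 1), p D j • (idem d e j *ᵥ w)) =
        e 1 (D - 1) • ∑ j ∈ Finset.range (D + 1), p D j • (idem d e j *ᵥ w) := by
      funext y
      simp only [radialMul, Pi.smul_apply, smul_eq_mul]
      by_cases hy : d x y = D - 1
      · rw [hy]
      have h4 : (∑ j ∈ Finset.range (D + 1), p D j • (idem d e j *ᵥ w)) y = 0 := by
        simp only [Finset.sum_apply, Pi.smul_apply, smul_eq_mul, Matrix.mulVec, dotProduct, idem,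
          Matrix.of_apply, Finset.mul_sum]
        rw [Finset.sum_comm]
        refine Finset.sum_eq_zero fun t _ => ?_
        simp_rw [← mul_assoc]
        rw [← Finset.sum_mul, H.inversion D le_rfl _ (H.dist_le y t)]
        split_ifs with ht
        · by_cases ht1 : d x t = 1
          · rw [H.dist_comm] at ht
            have h5 := H.near x t y ht1 ht
            have h6 := H.dist_le x y
            have h7 : d x y = D := by lia
            have := H.far x t y ht1 h7
            have := H.three_le
            lia
          · rw [hw t ht1, mul_zero]
        · rw [zero_mul]
      rw [h4, mul_zero, mul_zero]
    rw [h3, Matrix.mulVec_smul, Matrix.mulVec_sum]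
    simp_rw [Matrix.mulVec_smul, H.idem_mulVec_idem_mulVec]
    simp [show 0 < D from H.one_le]
  simp only [ha] at h1 h2 ⊢
  linear_combination h2 - p D 2 * h1

/-- The moments `g l = ⟨u, E_1 A*_l u⟩` vanish for `l > 2`; `g 0` is the norm, `g 1` comes from the
eigenvalue, and `g 0 + g 1 + g 2 = 0` because `u x = 0`. Inversion recovers the norms on spheres. -/
theorem sum_sq_sphere [Nonempty X] (H : IsQData d D e p q) {x : X} {u : X → ℝ} {lam : ℝ}
    (hu : idem d e 1 *ᵥ u = u) (hx : u x = 0)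
    (hl : ∀ z, (Fintype.card X : ℝ) * (idem d e 1 *ᵥ radialMul d x (e 1) u) z = lam * u z)
    {i : ℕ} (hi : i ≤ D) :
    (Fintype.card X : ℝ) * ∑ z, (if d x z = i then u z ^ 2 else 0) =
      (∑ z, u z ^ 2) * (p i 0 + p i 1 * lam - p i 2 * (1 + lam)) := by
  set g : ℕ → ℝ := fun l => ∑ z, e l (d x z) * u z ^ 2 with hg
  have hN := H.card_pos
  have hgl : ∀ l, g l = u ⬝ᵥ (idem d e 1 *ᵥ radialMul d x (e l) u) := by
    intro l
    rw [H.dotProduct_idem_mulVec, hu]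
    simp only [hg, dotProduct, radialMul]
    exact Finset.sum_congr rfl fun _ _ => by ring
  have hg0 : (Fintype.card X : ℝ) * g 0 = ∑ z, u z ^ 2 := by
    simp only [hg]
    simp_rw [H.trivial _ (H.dist_le x _)]
    rw [← Finset.mul_sum]
    field_simp
  have hg1 : (Fintype.card X : ℝ) * g 1 = lam * ∑ z, u z ^ 2 := by
    rw [hgl]
    simp only [dotProduct, Finset.mul_sum]
    refine Finset.sum_congr rfl fun z _ => ?_
    linear_combination u z * hl z
  have hg3 : ∀ l, 2 < l → g l = 0 := by
    intro l hl
    rw [hgl, H.idem_mulVec_radialMul_eq_zero (by lia) hu]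
    simp
  have hsum : ∀ c : ℕ → ℝ, ∑ z, (∑ l ∈ Finset.range (D + 1), c l * e l (d x z)) * u z ^ 2 =
      c 0 * g 0 + c 1 * g 1 + c 2 * g 2 := by
    intro c
    have h1 : ∑ l ∈ Finset.range (D + 1), c l * g l = c 0 * g 0 + c 1 * g 1 + c 2 * g 2 := by
      rw [sum_range_eq_three (n := 0) (g := fun j => c j * g j)]
      · intro l _ _ _
        rw [hg3 l (by lia), mul_zero]
      · intro l hl
        rw [hg3 l (by have := H.three_le; lia), mul_zero]
    rw [← h1]
    simp_rw [hg, Finset.mul_sum, Finset.sum_mul]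
    rw [Finset.sum_comm]
    exact Finset.sum_congr rfl fun _ _ => Finset.sum_congr rfl fun _ _ => by ring
  have h0 : g 0 + g 1 + g 2 = 0 := by
    have h := hsum 1
    simp only [Pi.one_apply, one_mul] at h
    rw [← h]
    refine Finset.sum_eq_zero fun z _ => ?_
    rw [H.sum_entries (H.dist_le x z)]
    split_ifs with hz
    · rw [← (H.dist_eq_zero x z).1 hz, hx]; simp
    · simp
  have hi' : ∑ z, (if d x z = i then u z ^ 2 else 0) = p i 0 * g 0 + p i 1 * g 1 + p i 2 * g 2 := by
    rw [← hsum]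
    refine Finset.sum_congr rfl fun z _ => ?_
    rw [H.inversion i hi _ (H.dist_le x z)]
    simp
  rw [hi']
  linear_combination (p i 0 - p i 2) * hg0 + (p i 1 - p i 2) * hg1 +
    p i 2 * (Fintype.card X : ℝ) * h0

/-! ### A tridiagonal form separating consecutive eigenvalues of `A_D` -/

/-- The matrix of the quadratic form `v ↦ ∑ (e_1 - e_1(D)) v²` in the basis `E_j x̂`. -/
noncomputable def shiftedForm (d : X → X → ℕ) (D : ℕ) (e : ℕ → ℕ → ℝ) (x : X) (j l : ℕ) : ℝ :=
  ∑ z, (e 1 (d x z) - e 1 D) * e j (d x z) * e l (d x z)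

theorem shiftedForm_comm (x : X) (j l : ℕ) :
    shiftedForm d D e x j l = shiftedForm d D e x l j :=
  Finset.sum_congr rfl fun _ _ => by ring

theorem shiftedForm_eq [Nonempty X] (H : IsQData d D e p q) {x : X} {j l : ℕ} (hj : j ≤ D)
    (hl : l ≤ D) (hjl : j ≠ l) :
    shiftedForm d D e x j l = (Fintype.card X : ℝ)⁻¹ * q l j * e l 0 := by
  have h := H.orth j l x x
  rw [if_neg hjl] at h
  simp_rw [H.dist_comm _ x] at h
  rw [← H.sum_triple hj hl x, shiftedForm]
  simp_rw [sub_mul, mul_assoc]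
  rw [Finset.sum_sub_distrib, ← Finset.mul_sum, h, mul_zero, sub_zero]

theorem shiftedForm_eq_zero [Nonempty X] (H : IsQData d D e p q) {x : X} {j l : ℕ} (hj : j ≤ D)
    (hl : l ≤ D) (h : l + 1 < j ∨ j + 1 < l) : shiftedForm d D e x j l = 0 := by
  rw [H.shiftedForm_eq hj hl (by lia), H.krein_eq_zero l hl j hj h]
  simp

theorem shiftedForm_pos [Nonempty X] (H : IsQData d D e p q) {x : X} {j : ℕ} (hj : j + 1 ≤ D) :
    0 < shiftedForm d D e x j (j + 1) := by
  rw [H.shiftedForm_eq (by lia) hj (by lia)]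
  have := H.card_pos
  have := H.krein_succ_pos hj
  have := H.pos (j + 1) hj
  positivity

/-- The combination `∑ p D l e_l` is the indicator of distance `D`, where the weight `e 1 - e 1 D`
is zero. -/
theorem sum_shiftedForm_eigenvalue (H : IsQData d D e p q) (x : X) (i : ℕ) :
    ∑ l ∈ Finset.range (D + 1), p D l * shiftedForm d D e x i l = 0 := by
  simp_rw [shiftedForm, Finset.mul_sum]
  rw [Finset.sum_comm]
  refine Finset.sum_eq_zero fun z _ => ?_
  have h : ∑ l ∈ Finset.range (D + 1),
      p D l * ((e 1 (d x z) - e 1 D) * e i (d x z) * e l (d x z)) =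
      (e 1 (d x z) - e 1 D) * e i (d x z) *
        ∑ l ∈ Finset.range (D + 1), p D l * e l (d x z) := by
    rw [Finset.mul_sum]
    exact Finset.sum_congr rfl fun _ _ => by ring
  rw [h, H.inversion D le_rfl _ (H.dist_le x z)]
  split_ifs with hz
  · simp [hz]
  · simp

theorem sum_shiftedForm [Nonempty X] (H : IsQData d D e p q) (x : X) (i : ℕ) :
    ∑ l ∈ Finset.range (D + 1), shiftedForm d D e x i l = (e 1 0 - e 1 D) * e i 0 := by
  simp_rw [shiftedForm]
  rw [Finset.sum_comm]
  simp_rw [← Finset.mul_sum, H.sum_entries (H.dist_le x _)]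
  rw [Finset.sum_eq_single x]
  · simp [H.dist_self]
  · intro z _ hz
    rw [if_neg fun h => hz ((H.dist_eq_zero x z).1 h).symm, mul_zero]
  · simp

theorem sum_truncated [Nonempty X] (H : IsQData d D e p q) (x : X) (y : ℕ → ℝ) {i j : ℕ}
    (hij : i ≤ j) (hj : j + 1 ≤ D) :
    ∑ l ∈ Finset.range (j + 1), y l * shiftedForm d D e x i l =
      ∑ l ∈ Finset.range (D + 1), y l * shiftedForm d D e x i l -
        if i = j then y (j + 1) * shiftedForm d D e x j (j + 1) else 0 := by
  have h1 : ∑ l ∈ Finset.range (D + 1), y l * shiftedForm d D e x i l =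
      ∑ l ∈ Finset.range (j + 2), y l * shiftedForm d D e x i l := by
    symm
    refine Finset.sum_subset (Finset.range_subset_range.2 (by lia)) fun l hl hl' => ?_
    rw [Finset.mem_range] at hl hl'
    rw [H.shiftedForm_eq_zero (by lia) (by lia) (by lia), mul_zero]
  rw [h1, Finset.sum_range_succ _ (j + 1)]
  split_ifs with h
  · subst h
    ring
  · rw [H.shiftedForm_eq_zero (j := i) (l := j + 1) (by lia) hj (by lia)]
    ring

theorem sum_sum_shiftedForm (x : X) (y : ℕ → ℝ) (s : Finset ℕ) :
    ∑ i ∈ s, y i * ∑ l ∈ s, y l * shiftedForm d D e x i l =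
      ∑ z, (e 1 (d x z) - e 1 D) * (∑ i ∈ s, y i * e i (d x z)) ^ 2 := by
  simp_rw [shiftedForm, sq, Finset.sum_mul_sum, Finset.mul_sum]
  rw [Finset.sum_comm (s := Finset.univ)]
  refine Finset.sum_congr rfl fun i _ => ?_
  rw [Finset.sum_comm]
  exact Finset.sum_congr rfl fun l _ => Finset.sum_congr rfl fun z _ => by ring

/-- The kernel relation is a three-term recurrence with nonzero off-diagonal entries, so two
consecutive zeros propagate down to `p D 0 > 0`. -/
theorem eigenvalue_consecutive_ne_zero [Nonempty X] (H : IsQData d D e p q) (n : ℕ)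
    (hn : n + 1 ≤ D) (h0 : p D n = 0) (h1 : p D (n + 1) = 0) : False := by
  obtain ⟨x⟩ := ‹Nonempty X›
  induction n with
  | zero => exact (H.eigenvalue_zero_pos le_rfl).ne' h0
  | succ n ih =>
    refine ih (by lia) ?_ h0
    have h := H.sum_shiftedForm_eigenvalue x (n + 1)
    rw [Finset.sum_eq_single n] at h
    · refine (mul_eq_zero.1 h).resolve_right ?_
      rw [shiftedForm_comm]
      exact (H.shiftedForm_pos (by lia)).ne'
    · intro l hl hln
      by_cases hl1 : l = n + 1
      · rw [hl1, h0, zero_mul]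
      by_cases hl2 : l = n + 2
      · rw [hl2, h1, zero_mul]
      · rw [H.shiftedForm_eq_zero (by lia) (by rw [Finset.mem_range] at hl; lia) (by lia),
          mul_zero]
    · intro hn'
      exact absurd (Finset.mem_range.2 (by lia)) hn'

/-- The form is nonnegative here. On the kernel vector truncated after index `j` it equals `-p D j *
p D (j + 1)` times a positive entry, so equal eigenvalues must both be zero. -/
theorem eigenvalue_ne_of_min [Nonempty X] (H : IsQData d D e p q)
    (hmin : ∀ i, 1 ≤ i → i ≤ D → e 1 D ≤ e 1 i) {j : ℕ} (hj : j + 1 ≤ D) :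
    p D j ≠ p D (j + 1) := by
  intro heq
  have x : X := Classical.arbitrary X
  have h1 := sum_sum_shiftedForm (d := d) (D := D) (e := e) x (p D) (Finset.range (j + 1))
  have h2 : ∀ i ∈ Finset.range (j + 1), p D i * ∑ l ∈ Finset.range (j + 1),
      p D l * shiftedForm d D e x i l =
      if i = j then - (p D j * p D (j + 1) * shiftedForm d D e x j (j + 1)) else 0 := by
    intro i hi
    rw [H.sum_truncated x _ (by rw [Finset.mem_range] at hi; lia) hj,
      H.sum_shiftedForm_eigenvalue]
    split_ifs with h
    · subst h; ring
    · ring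
  rw [Finset.sum_congr rfl h2, Finset.sum_ite_eq' , if_pos (by simp)] at h1
  have h3 : 0 ≤ ∑ z, (e 1 (d x z) - e 1 D) *
      (∑ i ∈ Finset.range (j + 1), p D i * e i (d x z)) ^ 2 := by
    refine Finset.sum_nonneg fun z _ => mul_nonneg ?_ (sq_nonneg _)
    by_cases hz : d x z = 0
    · rw [hz]
      exact sub_nonneg.2 (H.entry_one_lt le_rfl (by have := H.three_le; lia)).le
    · exact sub_nonneg.2 (hmin _ (by lia) (H.dist_le x z))
  have h4 := H.shiftedForm_pos (x := x) hj
  rw [← h1, ← heq] at h3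
  have h5 : p D j = 0 := by
    by_contra h
    have : 0 < p D j * p D j := mul_self_pos.2 h
    nlinarith [mul_pos this h4]
  exact H.eigenvalue_consecutive_ne_zero j hj h5 (heq ▸ h5)

/-- The form is now nonpositive except for its term at `x`. With `c` the common eigenvalue, the
shifted vector `p D - c` vanishes at `j` and `j + 1`, so its truncation costs nothing. The form
there is `c² h0 M`, its term at `x` is `c² h0 M²`, and `0 < M < 1` forces `c = 0`. -/
theorem eigenvalue_ne_of_max [Nonempty X] (H : IsQData d D e p q)
    (hmax : ∀ i, 1 ≤ i → i ≤ D → e 1 i ≤ e 1 D) {j : ℕ} (hj : j + 1 ≤ D) :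
    p D j ≠ p D (j + 1) := by
  classical
  intro heq
  have x : X := Classical.arbitrary X
  set c := p D j with hc
  set g : ℕ → ℝ := fun i => p D i - c with hg
  set h0 := e 1 0 - e 1 D
  have h0pos : 0 < h0 := sub_pos.2 (H.entry_one_lt le_rfl (by have := H.three_le; lia))
  set s := Finset.range (j + 1)
  set S := ∑ i ∈ s, g i * e i 0
  set M := ∑ i ∈ s, e i 0 with hM
  have hgj : g j = 0 := sub_self _
  have hgj1 : g (j + 1) = 0 := by simp [hg, ← heq]
  have h1 : ∀ i ∈ s, ∑ l ∈ s, g l * shiftedForm d D e x i l = -c * h0 * e i 0 := by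
    intro i hi
    rw [H.sum_truncated x _ (by rw [Finset.mem_range] at hi; lia) hj, hgj1]
    simp only [hg, sub_mul, Finset.sum_sub_distrib]
    rw [H.sum_shiftedForm_eigenvalue, ← Finset.mul_sum, H.sum_shiftedForm]
    simp
    ring
  have h2 : ∑ i ∈ s, ∑ l ∈ s, g l * shiftedForm d D e x i l = -c * h0 * M := by
    rw [Finset.sum_congr rfl h1, hM, Finset.mul_sum]
  -- Sum over `i` first: the full row sums of the form are known, and the row `l = j`, which
  -- truncation changes, has weight `g j = 0`.
  have h3 : ∑ i ∈ s, ∑ l ∈ s, g l * shiftedForm d D e x i l = h0 * S := by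
    rw [Finset.sum_comm, Finset.mul_sum]
    refine Finset.sum_congr rfl fun l hl => ?_
    by_cases hlj : l = j
    · subst hlj
      simp [hgj]
    · have h4 := H.sum_truncated x 1 (i := l) (by rw [Finset.mem_range] at hl; lia) hj
      simp only [Pi.one_apply, one_mul, H.sum_shiftedForm, if_neg hlj] at h4
      rw [← Finset.mul_sum, Finset.sum_congr rfl fun i _ => shiftedForm_comm x i l, h4]
      ring
  have hS : S = -c * M := by
    refine mul_left_cancel₀ h0pos.ne' ?_
    rw [← h3, h2]; ring
  have h5 := sum_sum_shiftedForm (d := d) (D := D) (e := e) x g s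
  have h6 : ∑ i ∈ s, g i * ∑ l ∈ s, g l * shiftedForm d D e x i l = -c * h0 * S := by
    rw [Finset.mul_sum]
    refine Finset.sum_congr rfl fun i hi => ?_
    rw [h1 i hi]; ring
  have h7 : ∑ z, (e 1 (d x z) - e 1 D) * (∑ i ∈ s, g i * e i (d x z)) ^ 2 ≤ h0 * S ^ 2 := by
    have h8 : ∀ z, (e 1 (d x z) - e 1 D) * (∑ i ∈ s, g i * e i (d x z)) ^ 2 ≤
        if z = x then h0 * S ^ 2 else 0 := by
      intro z
      split_ifs with hz
      · rw [hz, H.dist_self]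
      · refine mul_nonpos_of_nonpos_of_nonneg (sub_nonpos.2 (hmax _ ?_ (H.dist_le x z)))
          (sq_nonneg _)
        exact Nat.one_le_iff_ne_zero.2 fun h => hz ((H.dist_eq_zero x z).1 h).symm
    refine (Finset.sum_le_sum fun z _ => h8 z).trans ?_
    simp
  rw [← h5, h6, hS] at h7
  have hM0 : 0 < M := Finset.sum_pos (fun i hi => H.pos i (by
    rw [Finset.mem_range] at hi; lia)) ⟨0, by simp [s]⟩
  have hM1 : M < 1 := by
    have h9 := H.sum_entries (Nat.zero_le D)
    rw [if_pos rfl] at h9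
    rw [← h9]
    refine Finset.sum_lt_sum_of_subset (Finset.range_subset_range.2 (by lia))
      (i := j + 1) (by simp; lia) (by simp [s]) (H.pos _ hj) fun i hi _ => ?_
    exact (H.pos i (by rw [Finset.mem_range] at hi; lia)).le
  have h5 : c = 0 := by
    by_contra h
    have hcc : 0 < c * c := mul_self_pos.2 h
    have h10 : 0 < c * c * h0 * M * (1 - M) := by
      have : 0 < 1 - M := by linarith
      positivity
    nlinarith
  exact H.eigenvalue_consecutive_ne_zero j hj h5 (heq ▸ h5)

/-! ### The two families of thin vectors -/

theorem idem_mulVec_apply_self {x : X} {w : X → ℝ}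
    (hw : ∀ z, d x z ≠ 1 → w z = 0) (hs : ∑ z, w z = 0) : (idem d e 1 *ᵥ w) x = 0 := by
  have h : ∀ z, e 1 (d x z) * w z = e 1 1 * w z := by
    intro z
    by_cases hz : d x z = 1
    · rw [hz]
    · rw [hw z hz, mul_zero, mul_zero]
  simp only [Matrix.mulVec, dotProduct, idem, Matrix.of_apply, h]
  rw [← Finset.mul_sum, hs, mul_zero]

/-- Either every vector `E_1 w`, with `w` supported on the neighbours of `x` and of zero sum,
vanishes, or all these vectors vanish at distance `D` from `x` and consecutive eigenvalues of `A_D`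
differ. -/
theorem isThinVector_idem_mulVec [Nonempty X] (H : IsQData d D e p q) (x : X) :
    (∀ w : X → ℝ, (∀ z, d x z ≠ 1 → w z = 0) → ∑ z, w z = 0 → idem d e 1 *ᵥ w = 0) ∨
      ((∀ j, 1 ≤ j → j + 1 ≤ D → p D j ≠ p D (j + 1)) ∧
        ∀ w : X → ℝ, (∀ z, d x z ≠ 1 → w z = 0) → ∑ z, w z = 0 →
          IsThinVector d D e x (p D) (idem d e 1 *ᵥ w)) := by
  rw [or_iff_not_imp_left]
  intro hne
  push Not at hne
  obtain ⟨w₀, hw₀, hs₀, hu₀⟩ := hne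
  obtain ⟨a, b, hb, hm, hquad⟩ := H.exists_quadratic
  have hN := H.card_pos
  have h10 := H.pos 1 H.one_le
  have hD := H.three_le
  set N : ℝ := (Fintype.card X : ℝ) with hNdef
  set m := N * e 1 0 with hmdef
  have hmpos : 0 < m := by positivity
  set s := cosine e 1 1 with hs
  set r := cosine e 1 D with hr
  set s' := cosine e 2 1 with hs'
  set r' := cosine e 2 D with hr'
  have hκ := H.eigenvalue_zero_pos (le_refl D)
  have hs1 : s ≠ 1 := (H.cosine_one_lt H.one_le one_ne_zero).ne
  have hr1 : r ≠ 1 := (H.cosine_one_lt le_rfl (by lia)).ne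
  have hloc : ∀ w : X → ℝ, (∀ z, d x z ≠ 1 → w z = 0) → ∑ z, w z = 0 → ∀ z,
      (r - r') * (idem d e 1 *ᵥ radialMul d x (e 1) (idem d e 1 *ᵥ w)) z =
        e 1 0 * s * (r ^ 2 - r') * (idem d e 1 *ᵥ w) z := by
    intro w hw hsum z
    have h := H.local_eigenvector hw hsum z
    rw [H.eigenvalue_eq le_rfl H.one_le, H.eigenvalue_eq le_rfl H.two_le,
      H.entry_eq H.one_le (D - 1), H.cosine_pred H.one_le, H.entry_eq H.one_le 1] at h
    refine mul_left_cancel₀ hκ.ne' ?_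
    linear_combination h
  -- Equality would force `s = 0` or `r = 0`. The first gives equal cosines at distances `D - 1` and
  -- 1, and the second contradicts the quadratic relation at `D`.
  have hrr : r - r' ≠ 0 := by
    intro h0
    obtain ⟨z, hz⟩ := Function.ne_iff.1 hu₀
    have h := hloc w₀ hw₀ hs₀ z
    rw [h0, zero_mul] at h
    have h1 := (mul_eq_zero.1 h.symm).resolve_right hz
    have h2 : s * r * (r - 1) = 0 := by
      refine mul_left_cancel₀ h10.ne' ?_
      linear_combination h1 - e 1 0 * s * h0
    have h3 := (mul_eq_zero.1 h2).resolve_right (sub_ne_zero.2 hr1)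
    rcases mul_eq_zero.1 h3 with h4 | h4
    · have h5 := H.cosine_pred H.one_le
      rw [← hs, h4, zero_mul] at h5
      have h6 := H.entry_one_injOn (i := D - 1) (l := 1) (by lia) H.one_le (by
        rw [H.entry_eq H.one_le (D - 1), H.entry_eq H.one_le 1, h5, ← hs, h4])
      lia
    · have h5 := hquad D le_rfl
      rw [← hr, ← hr'] at h5
      have h6 : r' = 0 := by linarith
      rw [h4, h6] at h5
      norm_num at h5
  obtain ⟨lam, hlam⟩ : ∃ lam, lam * (r - r') = m * s * (r ^ 2 - r') :=
    ⟨m * s * (r ^ 2 - r') / (r - r'), div_mul_cancel₀ _ hrr⟩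
  have hl : ∀ w : X → ℝ, (∀ z, d x z ≠ 1 → w z = 0) → ∑ z, w z = 0 → ∀ z,
      N * (idem d e 1 *ᵥ radialMul d x (e 1) (idem d e 1 *ᵥ w)) z =
        lam * (idem d e 1 *ᵥ w) z := by
    intro w hw hsum z
    refine mul_left_cancel₀ hrr ?_
    linear_combination N * hloc w hw hsum z - (idem d e 1 *ᵥ w) z * hlam
  have hid : b + (1 + lam) * (1 + m * r) = 0 := by
    refine local_eigenvalue_identity (s := s) (s' := s') (r' := r') hm (hquad 1 H.one_le)
      (hquad D le_rfl) ?_ hs1 hr1 hlam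
    have h := hquad (D - 1) (by lia)
    rwa [H.cosine_pred H.one_le, H.cosine_pred H.two_le] at h
  -- The quadratic relation and `hid` factor the norm on `Γ_i(x)`; the factor `cosine e 1 i - r`
  -- vanishes at `i = D`, and its sign shows that `r` is extreme.
  have hnorm : ∀ w : X → ℝ, (∀ z, d x z ≠ 1 → w z = 0) → ∑ z, w z = 0 → ∀ i ≤ D,
      b * (N * ∑ z, (if d x z = i then (idem d e 1 *ᵥ w) z ^ 2 else 0)) =
        (∑ z, (idem d e 1 *ᵥ w) z ^ 2) * p i 0 * (1 - cosine e 1 i) * m *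
          ((1 + lam) * (cosine e 1 i - r)) := by
    intro w hw hsum i hi
    rw [H.sum_sq_sphere (by simp [H.idem_mulVec_idem_mulVec]) (idem_mulVec_apply_self hw hsum)
      (hl w hw hsum) hi, H.eigenvalue_eq hi H.one_le, H.eigenvalue_eq hi H.two_le]
    set U := ∑ z, (idem d e 1 *ᵥ w) z ^ 2
    have h1 := hquad i hi
    linear_combination U * p i 0 * (1 + lam) * h1 + U * p i 0 * (1 - cosine e 1 i) * hid +
      U * p i 0 * (1 + lam) * cosine e 1 i * (-hm)
  have hvan : ∀ w : X → ℝ, (∀ z, d x z ≠ 1 → w z = 0) → ∑ z, w z = 0 →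
      IsThinVector d D e x (p D) (idem d e 1 *ᵥ w) := by
    intro w hw hsum
    refine H.isThinVector_of_vanishing le_rfl (by simp [H.idem_mulVec_idem_mulVec])
      (idem_mulVec_apply_self hw hsum) fun z hz => ?_
    have h := hnorm w hw hsum D le_rfl
    rw [sub_self, mul_zero, mul_zero] at h
    have h1 := (mul_eq_zero.1 ((mul_eq_zero.1 h).resolve_left hb.ne')).resolve_left hN.ne'
    have h2 := (Finset.sum_eq_zero_iff_of_nonneg fun z _ => by
      split_ifs
      · exact sq_nonneg _
      · exact le_rfl).1 h1 z (Finset.mem_univ _)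
    rw [if_pos hz] at h2
    exact pow_eq_zero_iff two_ne_zero |>.1 h2
  refine ⟨?_, hvan⟩
  have hpos : 0 < ∑ z, (idem d e 1 *ᵥ w₀) z ^ 2 := by
    obtain ⟨z, hz⟩ := Function.ne_iff.1 hu₀
    exact Finset.sum_pos' (fun _ _ => sq_nonneg _) ⟨z, Finset.mem_univ _, by
      have : (idem d e 1 *ᵥ w₀) z ≠ 0 := hz
      positivity⟩
  have hsign : ∀ i, 1 ≤ i → i ≤ D → 0 ≤ (1 + lam) * (cosine e 1 i - r) := by
    intro i hi1 hi
    have h := hnorm w₀ hw₀ hs₀ i hi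
    have h1 : 0 ≤ ∑ z, (if d x z = i then (idem d e 1 *ᵥ w₀) z ^ 2 else 0) :=
      Finset.sum_nonneg fun z _ => by
        split_ifs
        · exact sq_nonneg _
        · exact le_rfl
    have h2 : 0 < 1 - cosine e 1 i := sub_pos.2 (H.cosine_one_lt hi (by lia))
    have h3 := H.eigenvalue_zero_pos hi
    have h4 : 0 < (∑ z, (idem d e 1 *ᵥ w₀) z ^ 2) * p i 0 * (1 - cosine e 1 i) * m := by
      positivity
    refine nonneg_of_mul_nonneg_right ?_ h4
    rw [← h]
    positivity
  intro j _ hj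
  rcases lt_trichotomy 0 (1 + lam) with h | h | h
  · refine H.eigenvalue_ne_of_min (fun i hi1 hi => ?_) hj
    rw [H.entry_eq H.one_le D, H.entry_eq H.one_le i]
    have := nonneg_of_mul_nonneg_right (hsign i hi1 hi) h
    exact mul_le_mul_of_nonneg_left (by linarith) h10.le
  · rw [← h] at hid
    linarith
  · refine H.eigenvalue_ne_of_max (fun i hi1 hi => ?_) hj
    rw [H.entry_eq H.one_le D, H.entry_eq H.one_le i]
    have := nonpos_of_mul_nonneg_right (hsign i hi1 hi) h
    exact mul_le_mul_of_nonneg_left (by linarith) h10.le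

theorem eigenvalue_one_ne (H : IsQData d D e p q) (j : ℕ) (_ : 1 ≤ j) (hj : j + 1 ≤ D) :
    p 1 j ≠ p 1 (j + 1) := fun h => by
  have := H.eigenvalue_inj j (by lia) (j + 1) hj h
  lia

/-- By the quadratic relation, the ratio `(s' - 1) / (s - s')` is `-1 - b / (1 + m s)`, which is
injective in `s`; the cosines at distances 1 and `D` differ. The proof clears the denominators. -/
theorem local_eigenvalue_ne [Nonempty X] (H : IsQData d D e p q) :
    (p D 2 - p D 0) * (p 1 1 - p 1 2) ≠ (p 1 2 - p 1 0) * (p D 1 - p D 2) := by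
  intro h
  obtain ⟨a, b, hb, hm, hquad⟩ := H.exists_quadratic
  have h10 := H.pos 1 H.one_le
  have hN := H.card_pos
  rw [H.eigenvalue_eq le_rfl H.one_le, H.eigenvalue_eq le_rfl H.two_le,
    H.eigenvalue_eq H.one_le H.one_le, H.eigenvalue_eq H.one_le H.two_le] at h
  have hs1 := (H.cosine_one_lt H.one_le one_ne_zero).ne
  have hr1 := (H.cosine_one_lt le_rfl (by have := H.three_le; lia : D ≠ 0)).ne
  have hs := hquad 1 H.one_le
  have hr := hquad D le_rfl
  have hκ := H.eigenvalue_zero_pos (le_refl D)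
  have hκ1 := H.eigenvalue_zero_pos H.one_le
  have hsr : cosine e 1 1 ≠ cosine e 1 D := by
    intro h1
    have := H.entry_one_injOn H.one_le le_rfl (by
      rw [H.entry_eq H.one_le 1, H.entry_eq H.one_le D, h1])
    have := H.three_le
    lia
  set m := (Fintype.card X : ℝ) * e 1 0
  have hmpos : 0 < m := by positivity
  set s := cosine e 1 1
  set r := cosine e 1 D
  set s' := cosine e 2 1
  set r' := cosine e 2 D
  have h1 : (p D 0 * p 1 0) * ((r' - 1) * (s - s') - (s' - 1) * (r - r')) = 0 := by
    linear_combination h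
  have h2 := (mul_eq_zero.1 h1).resolve_left (by positivity)
  have e1 : b * (s - s') = (1 - s) * (1 + m * s) := by
    linear_combination hs + s * (-hm)
  have e2 : b * (r - r') = (1 - r) * (1 + m * r) := by
    linear_combination hr + r * (-hm)
  have h3 : b * m * ((1 - s) * (1 - r)) * (s - r) = 0 := by
    linear_combination -b ^ 2 * h2 - b * (1 - r) * e1 + b * (1 - s) * e2
  have h4 := sub_ne_zero.2 hsr
  have h5 := sub_ne_zero.2 hs1.symm
  have h6 := sub_ne_zero.2 hr1.symm
  exact (mul_ne_zero (mul_ne_zero (mul_ne_zero hb.ne' hmpos.ne') (mul_ne_zero h5 h6)) h4) h3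

/-- The sum of a vector over `Γ_i(x) ∩ Γ_j(y)` is given by one formula for the two families of thin
vectors at `x`. -/
theorem exists_sum_inter_eq [Nonempty X] (H : IsQData d D e p q) (x y : X) {i j : ℕ} (hi : i ≤ D)
    (hj : j ≤ D) :
    ∃ β γ : ℝ, ∀ v : X → ℝ, (IsThinVector d D e x (p 1) v ∨ ∃ w : X → ℝ,
        (∀ z, d x z ≠ 1 → w z = 0) ∧ ∑ z, w z = 0 ∧ v = idem d e 1 *ᵥ w) →
      ∑ z, (if d x z = i ∧ d y z = j then v z else 0) =
        β * v y + γ * (idem d e 1 *ᵥ radialMul d x (e 1) v) y := by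
  have hN := H.card_pos
  obtain ⟨g', hg'⟩ := H.exists_sum_inter H.eigenvalue_one_ne x y hi hj
  rcases H.isThinVector_idem_mulVec x with hU | ⟨hne, hU⟩
  -- The second family is zero here, so the first alone determines the coefficients.
  · refine ⟨g', 0, ?_⟩
    rintro v (hv | ⟨w, hw, hs, rfl⟩)
    · rw [hg' v hv, zero_mul, add_zero]
    · simp [hU w hw hs]
  · obtain ⟨g, hg⟩ := H.exists_sum_inter hne x y hi hj
    have hd : p D 1 - p D 2 ≠ 0 := sub_ne_zero.2 (hne 1 le_rfl H.two_le)
    have hd' : p 1 1 - p 1 2 ≠ 0 := sub_ne_zero.2 (H.eigenvalue_one_ne 1 le_rfl H.two_le)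
    have key : ∃ β γ : ℝ,
        g = β + γ * ((p D 2 - p D 0) / (p D 1 - p D 2) * (Fintype.card X : ℝ)⁻¹) ∧
        g' = β + γ * ((p 1 2 - p 1 0) / (p 1 1 - p 1 2) * (Fintype.card X : ℝ)⁻¹) := by
      have hL : (p D 2 - p D 0) / (p D 1 - p D 2) * (Fintype.card X : ℝ)⁻¹ -
          (p 1 2 - p 1 0) / (p 1 1 - p 1 2) * (Fintype.card X : ℝ)⁻¹ ≠ 0 := by
        rw [← sub_mul]
        refine mul_ne_zero (sub_ne_zero.2 fun h => ?_) (inv_ne_zero hN.ne')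
        rw [div_eq_div_iff hd hd'] at h
        exact H.local_eigenvalue_ne h
      generalize (p D 2 - p D 0) / (p D 1 - p D 2) * (Fintype.card X : ℝ)⁻¹ = L at hL
      generalize (p 1 2 - p 1 0) / (p 1 1 - p 1 2) * (Fintype.card X : ℝ)⁻¹ = L' at hL
      refine ⟨g - (g - g') / (L - L') * L, (g - g') / (L - L'), by ring, ?_⟩
      field_simp
      ring
    obtain ⟨β, γ, h1, h2⟩ := key
    refine ⟨β, γ, ?_⟩
    rintro v (hv | ⟨w, hw, hs, rfl⟩)
    · have h3 := H.local_eigenvalue hv y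
      rw [hg' v hv, h2]
      have h4 : (idem d e 1 *ᵥ radialMul d x (e 1) v) y =
          (p 1 2 - p 1 0) / (p 1 1 - p 1 2) * ((Fintype.card X : ℝ)⁻¹ * v y) := by
        rw [div_mul_eq_mul_div, eq_div_iff hd', mul_comm, h3]
      rw [h4]; ring
    · have hv := hU w hw hs
      have h3 := H.local_eigenvalue hv y
      rw [hg _ hv, h1]
      have h4 : (idem d e 1 *ᵥ radialMul d x (e 1) (idem d e 1 *ᵥ w)) y =
          (p D 2 - p D 0) / (p D 1 - p D 2) *
            ((Fintype.card X : ℝ)⁻¹ * (idem d e 1 *ᵥ w) y) := by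
        rw [div_mul_eq_mul_div, eq_div_iff hd, mul_comm, h3]
      rw [h4]; ring

/-! ### Orthogonality and the balanced relation -/

/-- A vector of `E_1 V` that vanishes at `x` and is orthogonal to both families of thin vectors at
`x` is zero. -/
theorem eq_zero_of_orthogonal [Nonempty X] (H : IsQData d D e p q) {x : X} {t : X → ℝ}
    (h1 : idem d e 1 *ᵥ t = t) (hx : t x = 0)
    (h : ∀ v : X → ℝ, (IsThinVector d D e x (p 1) v ∨ ∃ w : X → ℝ,
        (∀ z, d x z ≠ 1 → w z = 0) ∧ ∑ z, w z = 0 ∧ v = idem d e 1 *ᵥ w) → t ⬝ᵥ v = 0) :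
    t = 0 := by
  classical
  -- Orthogonality to `E (ŷ - ẑ)` makes `t` constant on `Γ_1(x)`. Next, `(A_1 t) x = p 1 1 * t x =
  -- 0` makes the constant zero, so `t` lies in the first family and is orthogonal to itself.
  have hconst : ∀ y z, d x y = 1 → d x z = 1 → t y = t z := by
    intro y z hy hz
    have h2 := h _ (Or.inr ⟨Pi.single y 1 - Pi.single z 1, fun u hu => ?_, by simp, rfl⟩)
    · rw [H.dotProduct_idem_mulVec, h1, dotProduct_sub] at h2
      simpa [sub_eq_zero] using h2
    · have h3 : u ≠ y := by rintro rfl; exact hu hy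
      have h4 : u ≠ z := by rintro rfl; exact hu hz
      simp [h3, h4]
  have hsum : ∑ z, (if d x z = 1 then t z else 0) = 0 := by
    have h2 : ∀ z, (if d x z = 1 then t z else 0) =
        ∑ y, (if d x z = 1 then e 1 (d z y) else 0) * t y := by
      intro z
      split_ifs with hz
      · conv_lhs => rw [← h1]
        simp [Matrix.mulVec, dotProduct, idem]
      · simp
    simp_rw [h2]
    rw [Finset.sum_comm]
    simp_rw [← Finset.sum_mul, H.sum_sphere H.one_le H.one_le, mul_assoc]
    rw [← Finset.mul_sum]
    have h3 : ∑ y, e 1 (d x y) * t y = (idem d e 1 *ᵥ t) x := by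
      simp [Matrix.mulVec, dotProduct, idem]
    rw [h3, h1, hx, mul_zero]
  have hvan : ∀ z, d x z = 1 → t z = 0 := by
    intro z hz
    have h2 : ∀ y, (if d x y = 1 then t y else 0) = if d x y = 1 then t z else 0 := by
      intro y
      split_ifs with hy
      · exact hconst y z hy hz
      · rfl
    simp_rw [h2] at hsum
    rw [H.sum_sphere_const H.one_le] at hsum
    exact (mul_eq_zero.1 hsum).resolve_left (H.eigenvalue_zero_pos H.one_le).ne'
  exact dotProduct_self_eq_zero.1 (h t (Or.inl (H.isThinVector_of_vanishing H.one_le h1 hx hvan)))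

theorem norton_balanced [Nonempty X] (H : IsQData d D e p q) (x y : X) {i j : ℕ} (hi : i ≤ D)
    (hj : j ≤ D) :
    ∃ α β γ : ℝ, ∀ z₀, ∑ z, (if d x z = i ∧ d y z = j then e 1 (d z z₀) else 0) =
      α * e 1 (d x z₀) + β * e 1 (d y z₀) +
        γ * (idem d e 1 *ᵥ fun z => e 1 (d x z) * e 1 (d y z)) z₀ := by
  classical
  obtain ⟨β, γ, hβγ⟩ := H.exists_sum_inter_eq x y hi hj
  set χ : X → ℝ := fun z => if d x z = i ∧ d y z = j then 1 else 0 with hχ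
  set ψ : X → ℝ := fun z => e 1 (d x z) * e 1 (d y z) with hψ
  set b : X → ℝ := χ - β • Pi.single y 1 - γ • ψ with hb
  set t₀ : X → ℝ := idem d e 1 *ᵥ b with ht₀
  have h10 := H.pos 1 H.one_le
  -- Chosen so that `t₀ - α E x̂` vanishes at `x`. The test vectors vanish at `x`, so this term does
  -- not affect orthogonality.
  set α := t₀ x / e 1 0 with hα
  have hz : t₀ - α • (idem d e 1 *ᵥ Pi.single x 1) = 0 := by
    refine H.eq_zero_of_orthogonal (x := x) ?_ ?_ ?_
    · rw [Matrix.mulVec_sub, Matrix.mulVec_smul, ht₀, H.idem_mulVec_idem_mulVec,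
        H.idem_mulVec_idem_mulVec, if_pos rfl, if_pos rfl]
    · rw [Pi.sub_apply, Pi.smul_apply, H.idem_mulVec_single, H.dist_self, smul_eq_mul, hα,
        div_mul_cancel₀ _ h10.ne', sub_self]
    · intro v hv
      have hv1 : idem d e 1 *ᵥ v = v := by
        rcases hv with hv | ⟨w, _, _, rfl⟩
        · exact hv.idem_mulVec
        · simp [H.idem_mulVec_idem_mulVec]
      have hvx : v x = 0 := by
        rcases hv with hv | ⟨w, hw, hs, rfl⟩
        · exact hv.apply_self
        · exact idem_mulVec_apply_self hw hs
      have h1 := hβγ v hv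
      have h2 : t₀ - α • (idem d e 1 *ᵥ Pi.single x 1) =
          idem d e 1 *ᵥ (b - α • Pi.single x 1) := by
        rw [Matrix.mulVec_sub, Matrix.mulVec_smul]
      rw [h2, ← H.dotProduct_idem_mulVec, hv1, hb, sub_dotProduct, sub_dotProduct, sub_dotProduct,
        smul_dotProduct, smul_dotProduct, smul_dotProduct, single_dotProduct, single_dotProduct,
        hvx]
      have h3 : χ ⬝ᵥ v = ∑ z, (if d x z = i ∧ d y z = j then v z else 0) := by
        simp [hχ, dotProduct]
      have h4 : ψ ⬝ᵥ v = (idem d e 1 *ᵥ radialMul d x (e 1) v) y := by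
        simp only [hψ, dotProduct, Matrix.mulVec, idem, Matrix.of_apply, radialMul]
        exact Finset.sum_congr rfl fun _ _ => by ring
      rw [h3, h4, h1]
      simp
  refine ⟨α, β, γ, fun z₀ => ?_⟩
  have h1 := congrFun hz z₀
  rw [Pi.sub_apply, Pi.smul_apply, H.idem_mulVec_single, ht₀, hb, Matrix.mulVec_sub,
    Matrix.mulVec_sub, Matrix.mulVec_smul, Matrix.mulVec_smul, Pi.sub_apply, Pi.sub_apply,
    Pi.smul_apply, Pi.smul_apply, H.idem_mulVec_single] at h1
  have h2 : ∑ z, (if d x z = i ∧ d y z = j then e 1 (d z z₀) else 0) =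
      (idem d e 1 *ᵥ χ) z₀ := by
    simp [hχ, Matrix.mulVec, dotProduct, idem, H.dist_comm z₀]
  rw [h2]
  simp only [smul_eq_mul, Pi.zero_apply] at h1
  linear_combination h1

end IsQData

/-! ### From the graph to the numerical data -/

variable {X : Type*}

theorem exists_dist_one_dist_eq {Γ : SimpleGraph X} (hc : Γ.Connected) {x y : X} {n : ℕ}
    (h : Γ.dist x y = n + 1) : ∃ z, Γ.dist x z = 1 ∧ Γ.dist z y = n := by
  obtain ⟨w, hw⟩ := hc.exists_walk_length_eq_dist x y
  cases w with
  | nil => simp at h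
  | cons hadj w' =>
    rename_i z
    refine ⟨z, SimpleGraph.dist_eq_one_iff_adj.2 hadj, ?_⟩
    have h1 := SimpleGraph.dist_le w'
    have h2 := hc.dist_triangle (u := x) (v := z) (w := y)
    rw [SimpleGraph.dist_eq_one_iff_adj.2 hadj] at h2
    rw [SimpleGraph.Walk.length_cons] at hw
    lia

theorem dist_le_diam {Γ : SimpleGraph X} (hD : 3 ≤ Γ.diam) (x y : X) : Γ.dist x y ≤ Γ.diam :=
  SimpleGraph.dist_le_diam (SimpleGraph.ediam_ne_top_of_diam_ne_zero (by lia))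

theorem mem_sphere [Fintype X] {Γ : SimpleGraph X} {i : ℕ} {x y : X} :
    y ∈ sphere Γ i x ↔ Γ.dist x y = i := by
  simp [sphere]

theorem exists_entries_of_mem_boseMesner {Γ : SimpleGraph X} {B : Matrix X X ℝ}
    (hB : B ∈ boseMesner Γ) : ∃ c : ℕ → ℝ, ∀ x y, B x y = c (Γ.dist x y) := by
  unfold boseMesner at hB
  induction hB using Submodule.span_induction with
  | zero => exact ⟨0, fun _ _ => rfl⟩
  | add B B' _ _ h h' =>
    obtain ⟨c, hc⟩ := h
    obtain ⟨c', hc'⟩ := h'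
    exact ⟨c + c', fun x y => by simp [hc, hc']⟩
  | smul r B _ h =>
    obtain ⟨c, hc⟩ := h
    exact ⟨r • c, fun x y => by simp [hc]⟩
  | mem B hB =>
    obtain ⟨i, _, rfl⟩ := hB
    exact ⟨fun t => if t = i then 1 else 0, fun x y => rfl⟩

variable [Fintype X] [DecidableEq X]

theorem exists_dist_eq {Γ : SimpleGraph X} (hΓ : IsDistanceRegular Γ) (x : X) :
    ∀ i ≤ Γ.diam, ∃ z, Γ.dist x z = i := by
  have : Nonempty X := ⟨x⟩
  obtain ⟨u, v, huv⟩ := Γ.exists_dist_eq_diam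
  have h0 : ∃ z, Γ.dist x z = Γ.diam := by
    have h := hΓ.2 0 Γ.diam Γ.diam (Nat.zero_le _) le_rfl le_rfl x x u u (by simp) (by simp)
    rw [Finset.inter_self, Finset.inter_self] at h
    have h1 : 0 < (sphere Γ Γ.diam u).card := Finset.card_pos.2 ⟨v, mem_sphere.2 huv⟩
    rw [← h] at h1
    obtain ⟨z, hz⟩ := Finset.card_pos.1 h1
    exact ⟨z, mem_sphere.1 hz⟩
  intro i hi
  induction hi using Nat.decreasingInduction with
  | self => exact h0
  | of_succ k hk ih =>
    obtain ⟨z, hz⟩ := ih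
    rw [SimpleGraph.dist_comm] at hz
    obtain ⟨t, _, ht⟩ := exists_dist_one_dist_eq hΓ.1 hz
    exact ⟨t, by rw [SimpleGraph.dist_comm, ht]⟩

variable {Γ : SimpleGraph X} {E : Fin (Γ.diam + 1) → Matrix X X ℝ}

theorem exists_entries (hE : IsPrimitiveIdempotentOrdering Γ E) :
    ∃ e : ℕ → ℕ → ℝ, (∀ j : Fin (Γ.diam + 1), ∀ x y, E j x y = e j (Γ.dist x y)) ∧
      ∀ j, Γ.diam < j → ∀ i, e j i = 0 := by
  have hmem : ∀ j, E j ∈ boseMesner Γ := fun j =>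
    hE.span_eq ▸ Submodule.subset_span (Set.mem_range_self j)
  choose c hc using fun j => exists_entries_of_mem_boseMesner (hmem j)
  refine ⟨fun j => if h : j < Γ.diam + 1 then c ⟨j, h⟩ else 0, fun j x y => ?_, fun j hj i => ?_⟩
  · simp only [hc, dif_pos j.2]
  · simp only [dif_neg (show ¬ j < Γ.diam + 1 by lia)]
    rfl

theorem exists_eigenvalues (hE : IsPrimitiveIdempotentOrdering Γ E) :
    ∃ p : ℕ → ℕ → ℝ, ∀ i ≤ Γ.diam,
      distanceMatrix Γ i = ∑ j : Fin (Γ.diam + 1), p i j • E j := by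
  have h : ∀ i, ∃ c : Fin (Γ.diam + 1) → ℝ, i ≤ Γ.diam →
      distanceMatrix Γ i = ∑ j, c j • E j := by
    intro i
    by_cases hi : i ≤ Γ.diam
    · have hm : distanceMatrix Γ i ∈ Submodule.span ℝ (Set.range E) := by
        rw [hE.span_eq]
        exact Submodule.subset_span ⟨i, hi, rfl⟩
      obtain ⟨c, hc⟩ := (Submodule.mem_span_range_iff_exists_fun ℝ).1 hm
      exact ⟨c, fun _ => hc.symm⟩
    · exact ⟨0, fun h => absurd h hi⟩
  choose c hc using h
  refine ⟨fun i j => if h : j < Γ.diam + 1 then c i ⟨j, h⟩ else 0, fun i hi => ?_⟩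
  rw [hc i hi]
  exact Finset.sum_congr rfl fun j _ => by simp only [dif_pos j.2]

theorem distanceMatrix_mul_idempotent (hE : IsPrimitiveIdempotentOrdering Γ E) {p : ℕ → ℕ → ℝ}
    {i : ℕ} (hp : distanceMatrix Γ i = ∑ j : Fin (Γ.diam + 1), p i j • E j)
    (j : Fin (Γ.diam + 1)) : distanceMatrix Γ i * E j = p i j • E j := by
  rw [hp, Finset.sum_mul]
  simp [hE.mul_eq]

theorem distanceMatrix_one_mul (hΓ : IsDistanceRegular Γ) (hD : 3 ≤ Γ.diam) {i : ℕ}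
    (hi : i ≤ Γ.diam) : distanceMatrix Γ 1 * distanceMatrix Γ i =
      ∑ h ∈ Finset.range (Γ.diam + 1), (intersectionNumber Γ h 1 i : ℝ) • distanceMatrix Γ h := by
  ext x y
  rw [Matrix.mul_apply, Matrix.sum_apply]
  simp only [distanceMatrix, Matrix.of_apply, Matrix.smul_apply, smul_eq_mul]
  have h1 : ∀ z, (if Γ.dist x z = 1 then (1 : ℝ) else 0) * (if Γ.dist z y = i then 1 else 0) =
      if z ∈ sphere Γ 1 x ∩ sphere Γ i y then 1 else 0 := by
    intro z
    rw [SimpleGraph.dist_comm (u := z)]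
    simp only [Finset.mem_inter, mem_sphere]
    split_ifs <;> simp_all
  simp_rw [h1]
  rw [Finset.sum_boole, Finset.filter_mem_eq_inter, Finset.univ_inter,
    card_inter_eq_intersectionNumber hΓ (dist_le_diam hD x y) (by lia) hi rfl]
  simp [Nat.lt_succ_iff.2 (dist_le_diam hD x y)]

theorem intersectionNumber_eq_zero (hΓ : IsDistanceRegular Γ) {h i : ℕ} (hh : h ≤ Γ.diam)
    (hi : i + 1 < h) : intersectionNumber Γ h 1 i = 0 := by
  obtain ⟨x⟩ := hΓ.1.nonempty
  obtain ⟨y, hy⟩ := exists_dist_eq hΓ x h hh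
  rw [← card_inter_eq_intersectionNumber hΓ hh (by lia) (by lia) hy, Finset.card_eq_zero]
  refine Finset.eq_empty_of_forall_notMem fun z hz => ?_
  simp only [Finset.mem_inter, mem_sphere] at hz
  have := hΓ.1.dist_triangle (u := x) (v := z) (w := y)
  rw [SimpleGraph.dist_comm (u := z), hz.1, hz.2, hy] at this
  lia

theorem intersectionNumber_succ_ne_zero (hΓ : IsDistanceRegular Γ) {i : ℕ}
    (hi : i + 1 ≤ Γ.diam) : intersectionNumber Γ (i + 1) 1 i ≠ 0 := by
  obtain ⟨x⟩ := hΓ.1.nonempty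
  obtain ⟨y, hy⟩ := exists_dist_eq hΓ x _ hi
  rw [← card_inter_eq_intersectionNumber hΓ hi (by lia) (by lia) hy, Finset.card_ne_zero]
  obtain ⟨z, hz1, hz⟩ := exists_dist_one_dist_eq hΓ.1 hy
  exact ⟨z, Finset.mem_inter.2 ⟨mem_sphere.2 hz1, mem_sphere.2 (by
    rw [SimpleGraph.dist_comm, hz])⟩⟩

/-- `A_1` generates the Bose-Mesner algebra: the recurrence of the `A_i` makes `p i j` depend only
on `p 1 j`. If `p 1` agreed at distinct `j` and `l`, then `E_j` would act on `E_j` and on `E_l` by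
the same scalar, although `E_j E_l = 0`. -/
theorem eigenvalue_one_inj (hΓ : IsDistanceRegular Γ) (hD : 3 ≤ Γ.diam)
    (hE : IsPrimitiveIdempotentOrdering Γ E) {p : ℕ → ℕ → ℝ}
    (hp : ∀ i ≤ Γ.diam, distanceMatrix Γ i = ∑ j : Fin (Γ.diam + 1), p i j • E j)
    (j l : Fin (Γ.diam + 1)) (h : p 1 j = p 1 l) : j = l := by
  have hne : ∀ j, E j ≠ 0 := fun j => hE.linearIndependent.ne_zero j
  have hrec : ∀ i ≤ Γ.diam, ∀ j : Fin (Γ.diam + 1), p 1 j * p i j =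
      ∑ h ∈ Finset.range (Γ.diam + 1), (intersectionNumber Γ h 1 i : ℝ) * p h j := by
    intro i hi j
    have h1 := congrArg (· * E j) (distanceMatrix_one_mul hΓ hD hi)
    simp only [Matrix.mul_assoc, Finset.sum_mul, Matrix.smul_mul] at h1
    rw [distanceMatrix_mul_idempotent hE (hp i hi), Matrix.mul_smul,
      distanceMatrix_mul_idempotent hE (hp 1 (by lia)), Finset.sum_congr rfl fun h hh => by
        rw [distanceMatrix_mul_idempotent hE (hp h (by rw [Finset.mem_range] at hh; lia))]] at h1
    simp only [smul_smul, ← Finset.sum_smul] at h1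
    rw [mul_comm]
    exact smul_left_injective ℝ (hne j) h1
  have hzero : ∀ j : Fin (Γ.diam + 1), p 0 j = 1 := by
    intro j
    have h1 := distanceMatrix_mul_idempotent hE (hp 0 (Nat.zero_le _)) j
    have h2 : distanceMatrix Γ 0 = 1 := by
      ext x y
      simp only [distanceMatrix, Matrix.of_apply, hΓ.1.dist_eq_zero_iff, Matrix.one_apply]
    rw [h2, one_mul] at h1
    refine smul_left_injective ℝ (hne j) ?_
    simp only [one_smul]
    exact h1.symm
  have hall : ∀ i, i ≤ Γ.diam → p i j = p i l := by
    intro i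
    induction i using Nat.strong_induction_on with
    | _ i ih =>
      intro hi
      rcases i with _ | i
      · rw [hzero, hzero]
      have key : ∀ t : Fin (Γ.diam + 1), (intersectionNumber Γ (i + 1) 1 i : ℝ) * p (i + 1) t =
          p 1 t * p i t -
            ∑ h ∈ Finset.range (i + 1), (intersectionNumber Γ h 1 i : ℝ) * p h t := by
        intro t
        rw [hrec i (by lia)]
        have : ∑ h ∈ Finset.range (Γ.diam + 1), (intersectionNumber Γ h 1 i : ℝ) * p h t =
            ∑ h ∈ Finset.range (i + 2), (intersectionNumber Γ h 1 i : ℝ) * p h t := by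
          symm
          refine Finset.sum_subset (Finset.range_subset_range.2 (by lia)) fun h h1 h2 => ?_
          rw [Finset.mem_range] at h1 h2
          rw [intersectionNumber_eq_zero hΓ (by lia) (by lia), Nat.cast_zero, zero_mul]
        rw [this, Finset.sum_range_succ]
        ring
      have h1 := key j
      rw [h, ih i (by lia) (by lia), Finset.sum_congr rfl fun t ht => by
        rw [ih t (Finset.mem_range.1 ht) (by have := Finset.mem_range.1 ht; lia)], ← key l] at h1
      exact mul_left_cancel₀ (Nat.cast_ne_zero.2 (intersectionNumber_succ_ne_zero hΓ hi)) h1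
  obtain ⟨e, he, _⟩ := exists_entries hE
  have hexp : E j = ∑ i ∈ Finset.range (Γ.diam + 1), e j i • distanceMatrix Γ i := by
    ext x y
    rw [Matrix.sum_apply, he]
    simp [distanceMatrix, Nat.lt_succ_iff.2 (dist_le_diam hD x y)]
  have hmul : ∀ t, E j * E t = (∑ i ∈ Finset.range (Γ.diam + 1), e j i * p i t) • E t := by
    intro t
    rw [hexp, Finset.sum_mul, Finset.sum_smul]
    refine Finset.sum_congr rfl fun i hi => ?_
    rw [Matrix.smul_mul, distanceMatrix_mul_idempotent hE (hp i (by
      rw [Finset.mem_range] at hi; lia)), smul_smul]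
  by_contra hjl
  have h1 := hmul j
  have h2 := hmul l
  rw [hE.mul_eq, if_pos rfl] at h1
  rw [hE.mul_eq, if_neg hjl, eq_comm, smul_eq_zero_iff_left (hne l)] at h2
  rw [Finset.sum_congr rfl fun i hi => by
    rw [hall i (by rw [Finset.mem_range] at hi; lia)], h2, zero_smul] at h1
  exact hne j h1

theorem exists_isQData (hΓ : IsDistanceRegular Γ) (hD : 3 ≤ Γ.diam)
    (hE : IsQPolynomialOrdering Γ E) (ha : a Γ Γ.diam = 0) :
    ∃ e p q : ℕ → ℕ → ℝ, IsQData Γ.dist Γ.diam e p q ∧ E 1 = idem Γ.dist e 1 := by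
  have hE' := hE.toIsPrimitiveIdempotentOrdering
  obtain ⟨e, he, he0⟩ := exists_entries hE'
  obtain ⟨p, hp⟩ := exists_eigenvalues hE'
  have hX : Nonempty X := hΓ.1.nonempty
  have hc := hΓ.1
  have h1v : ((1 : Fin (Γ.diam + 1)) : ℕ) = 1 := by
    rw [Fin.val_one', Nat.mod_eq_of_lt (by lia)]
  have hent : ∀ j (hj : j ≤ Γ.diam) x y, e j (Γ.dist x y) = E ⟨j, Nat.lt_succ_iff.2 hj⟩ x y :=
    fun j hj x y => (he ⟨j, _⟩ x y).symm
  have horth : ∀ i j x y, ∑ z, e i (Γ.dist x z) * e j (Γ.dist z y) =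
      if i = j then e i (Γ.dist x y) else 0 := by
    intro i j x y
    by_cases hi : Γ.diam < i
    · simp [he0 i hi]
    by_cases hj : Γ.diam < j
    · by_cases hij : i = j
      · lia
      · simp [he0 j hj, hij]
    push Not at hi hj
    simp_rw [hent i hi, hent j hj]
    rw [← Matrix.mul_apply, hE'.mul_eq]
    simp only [Fin.mk.injEq]
    split_ifs <;> rfl
  refine ⟨e, p, fun h j => if hh : h ≤ Γ.diam ∧ j ≤ Γ.diam then
    krein E ⟨h, Nat.lt_succ_iff.2 hh.1⟩ 1 ⟨j, Nat.lt_succ_iff.2 hh.2⟩ else 0, ?_, ?_⟩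
  · refine
    { three_le := hD
      dist_eq_zero := fun x y => hc.dist_eq_zero_iff
      dist_comm := fun x y => SimpleGraph.dist_comm
      dist_le := dist_le_diam hD
      exists_dist_eq := exists_dist_eq hΓ
      orth := horth
      pos := ?_
      eq_zero := he0
      trivial := ?_
      inversion := ?_
      krein := ?_
      krein_eq_zero := ?_
      krein_ne_zero := ?_
      eigenvalue_inj := ?_
      far := ?_
      near := ?_ }
    · intro j hj
      obtain ⟨x⟩ := hX
      have hsum : ∀ x, e j 0 = ∑ z, e j (Γ.dist x z) ^ 2 := by
        intro x
        have h := horth j j x x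
        rw [if_pos rfl, SimpleGraph.dist_self] at h
        rw [← h]
        refine Finset.sum_congr rfl fun z _ => ?_
        rw [SimpleGraph.dist_comm (u := z), sq]
      have hnn : 0 ≤ e j 0 := by
        rw [hsum x]
        exact Finset.sum_nonneg fun _ _ => sq_nonneg _
      refine lt_of_le_of_ne hnn fun h0 => ?_
      refine hE.linearIndependent.ne_zero ⟨j, Nat.lt_succ_iff.2 hj⟩ ?_
      ext x y
      rw [he]
      have h1 := hsum x
      rw [← h0] at h1
      have h2 := (Finset.sum_eq_zero_iff_of_nonneg fun z _ => sq_nonneg _).1 h1.symm y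
        (Finset.mem_univ _)
      exact pow_eq_zero_iff two_ne_zero |>.1 h2
    · intro i hi
      obtain ⟨x⟩ := hX
      obtain ⟨y, rfl⟩ := exists_dist_eq hΓ x i hi
      rw [hent 0 (Nat.zero_le _)]
      have h0 := hE.zero_eq
      change E 0 x y = _
      rw [h0]
      simp
    · intro i hi l hl
      obtain ⟨x⟩ := hX
      obtain ⟨y, rfl⟩ := exists_dist_eq hΓ x l hl
      have h := congrFun (congrFun (hp i hi) x) y
      rw [Matrix.sum_apply] at h
      simp only [distanceMatrix, Matrix.of_apply, Matrix.smul_apply, he, smul_eq_mul] at h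
      rw [h, Finset.sum_range]
    · intro j hj l hl
      obtain ⟨x⟩ := hX
      obtain ⟨y, rfl⟩ := exists_dist_eq hΓ x l hl
      have h := congrFun (congrFun (isKrein_krein hE' 1 ⟨j, Nat.lt_succ_iff.2 hj⟩) x) y
      rw [Matrix.hadamard_apply, Matrix.smul_apply, Matrix.sum_apply] at h
      simp only [Matrix.smul_apply, he, smul_eq_mul, h1v] at h
      rw [h, Finset.sum_range]
      congr 1
      refine Finset.sum_congr rfl fun h _ => ?_
      rw [dif_pos ⟨Nat.lt_succ_iff.1 h.2, hj⟩]
    · intro h hh j hj hhj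
      rw [dif_pos ⟨hh, hj⟩]
      refine hE.krein_eq_zero _ _ _ ?_
      rw [h1v]
      lia
    · intro j hj
      rw [dif_pos ⟨hj, by lia⟩]
      refine hE.krein_ne_zero _ _ _ (Or.inl ?_)
      rw [h1v]
      lia
    · intro j hj l hl h
      exact Fin.mk.inj_iff.1 (eigenvalue_one_inj hΓ hD hE' hp ⟨j, Nat.lt_succ_iff.2 hj⟩
        ⟨l, Nat.lt_succ_iff.2 hl⟩ h)
    · intro x y z hxy hxz
      have h1 := hc.dist_triangle (u := x) (v := y) (w := z)
      have h2 := dist_le_diam hD y z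
      -- Otherwise `y` would be counted by `a_D`, which is zero.
      have h3 : Γ.dist y z ≠ Γ.diam := by
        intro h
        have h4 := card_inter_eq_intersectionNumber hΓ le_rfl (by lia : 1 ≤ Γ.diam) le_rfl hxz
        have h5 : intersectionNumber Γ Γ.diam 1 Γ.diam = 0 := ha
        rw [h5, Finset.card_eq_zero] at h4
        have h6 : y ∈ sphere Γ 1 x ∩ sphere Γ Γ.diam z :=
          Finset.mem_inter.2 ⟨mem_sphere.2 hxy, mem_sphere.2 (by
            rw [SimpleGraph.dist_comm, h])⟩
        rw [h4] at h6
        simp at h6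
      lia
    · intro x y z hxy hyz
      have h1 := hc.dist_triangle (u := y) (v := x) (w := z)
      rw [SimpleGraph.dist_comm (u := y) (v := x)] at h1
      lia
  · ext x y
    rw [he, h1v]
    rfl

end DRG

theorem mainTheorem4 {X : Type*} [Fintype X] [DecidableEq X] (Γ : SimpleGraph X)
    (hΓ : DRG.IsDistanceRegular Γ) (hD : 3 ≤ Γ.diam) (hk : 3 ≤ DRG.valency Γ)
    (E : Fin (Γ.diam + 1) → Matrix X X ℝ) (hE : DRG.IsQPolynomialOrdering Γ E)
    (hT : DRG.IsTight Γ E) :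
    DRG.IsNortonBalanced Γ (E 1) := by
  intro x y i j hi hj
  have : Nonempty X := ⟨x⟩
  obtain ⟨e, p, q, H, h1⟩ := DRG.exists_isQData hΓ hD hE hT.2.1
  obtain ⟨α, β, γ, h⟩ := H.norton_balanced x y hi hj
  rw [Submodule.mem_span_triple]
  refine ⟨α, β, γ, ?_⟩
  funext z₀
  have h2 : ∀ x z, DRG.proj (E 1) x z = e 1 (Γ.dist x z) := fun x z => by
    rw [DRG.proj, h1, H.idem_mulVec_single]
  simp only [Pi.add_apply, Pi.smul_apply, Finset.sum_apply, smul_eq_mul, DRG.nortonProduct, h2]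
  rw [h1, ← h z₀, ← Finset.sum_filter]
  refine Finset.sum_congr ?_ fun _ _ => rfl
  ext z
  simp [DRG.mem_sphere]
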